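/- **Setting.** Let $m,n,N\in\mathbb N$. Let $f:\mathbb R^n\to\mathbb R^n$ be continuous, $\Gamma\in\mathbb R^{n\times n}$, $c>0$, $\varepsilon>0$. For each mode $u\in\{1,\dots,N\}$ let $L(u)$ be the Laplacian matrix of an undirected graph on $\{1,\dots,m\}$ ($L_{ij}=-1$ for linked $i\ne j$, $L_{ij}=0$ for other $i\neq j$, zero row sums) and $D_i(u)\in\{0,1\}$ the indicator of a set of pinned nodes, $D(u)=\mathrm{diag}(D_i(u))$. Let $\dot s=f(s)$ on $[0,\infty)$. Let $\sigma_t$ be a homogeneous continuous-time Markov chain on $\{1,\dots,N\}$ with generator $Q=[q_{uv}]$ and right-continuous paths with left limits, relative to a filtration. The network, started at a deterministic $x(0)=x_0$, has adapted, continuous node states $x_i(t)\in\mathbb R^n$ on $[0,\infty)$. With event times $0=t^i_0\le t^i_1\le\cdots\le\infty$ of node $i$, and with $$\phi_i(u,y,w)=\sum_j L_{ij}(u)\Gamma(y_j-y_i)+\varepsilon D_i(u)\Gamma(y_i-w),$$ $$\dot x_i(t)=f(x_i(t))-c\,\phi_i\big(\sigma_t,x(t^i_k),s(t^i_k)\big),\qquad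 t^i_k\le t<t^i_{k+1},$$ as long as every node is between two successive event times (derivatives are taken from the right). Put $\hat x_i=x_i-s$ and, for $t \ge t^i_k$, $$z_i(t)=\phi_i(\sigma_t,x(t),s(t))-\phi_i(\sigma_t,x(t^i_k),s(t^i_k)).$$ Given a threshold $h_i(t)$, the rule is $t^i_{k+1}=\sup\{\tau\ge t^i_k:\ \|z_i(r)\|\le h_i(r)\text{ for all }r\in[t^i_k,\tau]\}$, with $t^i_{k+1}=\infty$ if $t^i_k=\infty$. **Hypotheses.** $\alpha,\beta>0$, $G\in\mathbb R^{n\times n}$ is symmetric positive definite, and $$(\xi-\zeta)^\top G\,[f(\xi)-f(\zeta)-\alpha\Gamma(\xi-\zeta)]\le-\beta(\xi-\zeta)^\top G(\xi-\zeta)\quad\text{for all }\xi,\zeta\in\mathbb R^n.$$ There are diagonal positive definite matrices $P(1),\dots,P(N)$ such that, for every $u$, with $\{M\}^{sym}=(M+M^\top)/2$, $$\{P(u)[\alpha I_m-cL(u)-c\varepsilon D(u)]\otimes G\Gamma\}^{sym}+\tfrac12\sum_v q_{uv}P(v)\otimes G\le0$$ (negative semidefinite). Let $\underline\lambda$ and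 $\bar\lambda$ be the smallest and the largest modulus of the eigenvalues of the matrices $P(u)\otimes G$, $u=1,\dots,N$. **Proposition 1.** 1. Let $0<\delta<2\beta\underline\lambda/\bar\lambda$ and let the rule have threshold $h_i(t)=\dfrac{\beta\underline\lambda-\frac12\delta\bar\lambda}{\sqrt c\,\bar\lambda}\|\hat x_i(t)\|$. For every path and every time $t$ before which no node's event times have broken down (that is, at each earlier time every node is between two successive event times): if the system is not stabilized at time $t$, i.e. $\hat x(t)\ne0$, then there are a node $i$ and an index $k$ with $t^i_k\le t<t^i_{k+1}$. So at least one node has a next event time strictly after $t$ and a strictly positive inter-event interval. 2. Let $a,b>0$ and let the rule have threshold $h_i(t)=a e^{-bt}$. Then: * on every path, $t^i_k<t^i_{k+1}$ for all $i$ and all $k$ with $t^i_k<\infty$, and $t^i_k\to\infty$ as $k\to\infty$ for every $i$; so Zeno behavior is excluded; * for every $R\ge0$ there is a constant $\eta>0$ such that for every node $i$ and every $k$, the expected next inter-event interval of the events that occur up to time $R$ is bounded below by $\eta$: $\ \mathbb E\big[(t^i_{k+1}-t^i_k)\mathbf 1_{\{t^i_k\le R\}}\big]\ge\eta\,\mathbb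 P(t^i_k\le R)$; * if moreover $b<\beta\underline\lambda/\bar\lambda$ and $f$ is globally Lipschitz, the bound is uniform in time: for every $l\ge0$ there is a constant $\eta>0$ such that for every node $i$ and every $t\ge0$, the expectation of the shortest interval $t^i_{k+1}-t^i_k$ among those with $t^i_k\le t+l$ and $t^i_{k+1}>t$ is at least $\eta$. In particular (with $k_i(t)$ the index of the latest event of node $i$ up to time $t$) $\ \mathbb E\big[t^i_{k_i(t)+1}-t^i_{k_i(t)}\big]\ge\eta$ for all $t\ge0$ and all $i$. -/

import Mathlib

open MeasureTheory Filter Topology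
open scoped NNReal ENNReal Kronecker

noncomputable section

/-- The state space `ℝⁿ` with the Euclidean norm. -/
abbrev State (n : ℕ) : Type := EuclideanSpace ℝ (Fin n)

/-- A matrix acting on `ℝⁿ`. -/
def act {n : ℕ} (A : Matrix (Fin n) (Fin n) ℝ) (v : State n) : State n :=
  Matrix.toEuclideanCLM (𝕜 := ℝ) A v

/-- The data of a pinned network with `m` nodes, node states in `ℝⁿ` and `N` modes. -/
structure PinnedNetwork (m n N : ℕ) where
  /-- the node dynamics -/
  f : State n → State n
  /-- the inner coupling matrix -/
  Γ : Matrix (Fin n) (Fin n) ℝ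
  /-- the coupling strength -/
  c : ℝ
  /-- the pinning gain -/
  ε : ℝ
  /-- the undirected coupling graph of each mode -/
  graph : Fin N → SimpleGraph (Fin m)
  /-- the set of pinned nodes of each mode -/
  pinned : Fin N → Finset (Fin m)
  /-- the target trajectory -/
  s : ℝ≥0 → State n

namespace PinnedNetwork

variable {m n N : ℕ}

open Classical in
/-- The Laplacian matrix: `-1` for linked nodes, the degree on the diagonal. -/
def lap (S : PinnedNetwork m n N) (u : Fin N) : Matrix (Fin m) (Fin m) ℝ :=
  (S.graph u).lapMatrix ℝ

/-- The indicator of the pinned nodes. -/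
def pin (S : PinnedNetwork m n N) (u : Fin N) (i : Fin m) : ℝ :=
  if i ∈ S.pinned u then 1 else 0

/-- Diffusion and pinning term of node `i` in mode `u`, for node states `y` and target state `w`:
`∑ⱼ Lᵢⱼ Γ (yⱼ - yᵢ) + ε Dᵢ Γ (yᵢ - w)`. -/
def feedback (S : PinnedNetwork m n N) (u : Fin N) (i : Fin m)
    (y : Fin m → State n) (w : State n) : State n :=
  (∑ j, S.lap u i j • act S.Γ (y j - y i)) + (S.ε * S.pin u i) • act S.Γ (y i - w)

/-- The measurement error `zᵢ` at time `t` in mode `u`, for the latest event time `r`: the feedback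
term with current data minus the one with the data sampled at time `r`. -/
def meas (S : PinnedNetwork m n N) (u : Fin N) (i : Fin m)
    (x : ℝ≥0 → Fin m → State n) (r t : ℝ≥0) : State n :=
  S.feedback u i (x t) (S.s t) - S.feedback u i (x r) (S.s r)

/-- The target trajectory solves `s' = f(s)`. -/
def IsTarget (S : PinnedNetwork m n N) : Prop :=
  ∀ t : ℝ≥0, HasDerivWithinAt (fun r : ℝ => S.s r.toNNReal) (S.f (S.s t)) (Set.Ici 0) (t : ℝ)

/-- All nodes are in operation at time `t`: each of them is between two successive event times.
As event times are nondecreasing, they are then in operation at all earlier times as well. -/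
def Alive (T : Fin m → ℕ → ℝ≥0∞) (t : ℝ≥0) : Prop :=
  ∀ j, ∃ l, T j l ≤ t ∧ (t : ℝ≥0∞) < T j (l + 1)

/-- One path of the event-triggered network. Here `u` is the path of modes, `x` the path of node
states, `T i k` the `k`-th event time of node `i` (`⊤` if there are fewer events), and the rule is
given by the threshold `thr t e`, a function of the time `t` and of the error `e = xᵢ(t) - s(t)`.

Events may accumulate at a finite time, or one may follow another at once. The differential
equation is imposed as long as this has not happened to any node. At jump times of the mode the
derivative is the one from the right. -/
structure IsRun (S : PinnedNetwork m n N) (thr : ℝ≥0 → State n → ℝ)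
    (u : ℝ≥0 → Fin N) (x : ℝ≥0 → Fin m → State n) (T : Fin m → ℕ → ℝ≥0∞) : Prop where
  continuous : Continuous x
  first_event : ∀ i, T i 0 = 0
  /-- The next event occurs when the inequality `‖zᵢ‖ ≤ thr` stops to hold. -/
  next_event : ∀ i k, T i k ≠ ⊤ →
    T i (k + 1) = sSup {τ : ℝ≥0∞ | ∃ r : ℝ≥0, τ = r ∧ T i k ≤ r ∧
      ∀ q : ℝ≥0, T i k ≤ q → q ≤ r →
        ‖S.meas (u q) i x (T i k).toNNReal q‖ ≤ thr q (x q i - S.s q)}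
  no_event : ∀ i k, T i k = ⊤ → T i (k + 1) = ⊤
  /-- `xᵢ'(t) = f(xᵢ(t)) + θᵢ`, with the feedback sampled at the latest event. -/
  dynamics : ∀ t : ℝ≥0, Alive T t → ∀ i k, T i k ≤ t → (t : ℝ≥0∞) < T i (k + 1) →
    HasDerivWithinAt (fun r : ℝ => x r.toNNReal i)
      (S.f (x t i) -
        S.c • S.feedback (u t) i (x (T i k).toNNReal) (S.s (T i k).toNNReal))
      (Set.Ici (t : ℝ)) (t : ℝ)

end PinnedNetwork

/-- `f` belongs to the class `QUAD(G, αΓ, β)`. -/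
def IsQUAD {n : ℕ} (f : State n → State n) (G Γ : Matrix (Fin n) (Fin n) ℝ) (α β : ℝ) : Prop :=
  Continuous f ∧ ∀ ξ ζ : State n,
    inner ℝ (ξ - ζ) (act G (f ξ - f ζ - α • act Γ (ξ - ζ))) ≤
      -β * inner ℝ (ξ - ζ) (act G (ξ - ζ))

/-- The matrix `P(u) ⊗ G`, where `P(u)` is diagonal with entries `p u i`. -/
def lyap {m n N : ℕ} (p : Fin N → Fin m → ℝ) (G : Matrix (Fin n) (Fin n) ℝ) (u : Fin N) :
    Matrix (Fin m × Fin n) (Fin m × Fin n) ℝ :=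
  Matrix.diagonal (p u) ⊗ₖ G

/-- The smallest modulus of an eigenvalue of the matrices `P(u) ⊗ G`. -/
def lamMin {m n N : ℕ} (p : Fin N → Fin m → ℝ) (G : Matrix (Fin n) (Fin n) ℝ) : ℝ :=
  ⨅ u, sInf ((fun μ : ℝ => |μ|) '' spectrum ℝ (lyap p G u))

/-- The largest modulus of an eigenvalue of the matrices `P(u) ⊗ G`. -/
def lamMax {m n N : ℕ} (p : Fin N → Fin m → ℝ) (G : Matrix (Fin n) (Fin n) ℝ) : ℝ :=
  ⨆ u, sSup ((fun μ : ℝ => |μ|) '' spectrum ℝ (lyap p G u))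

/-- The symmetric part of a square matrix. -/
def symPart {ι : Type*} (M : Matrix ι ι ℝ) : Matrix ι ι ℝ := (1 / 2 : ℝ) • (M + M.transpose)

/-- The matrix inequality
`{P(u)[α I - c L(u) - c ε D(u)] ⊗ GΓ}^sym + (1/2) ∑ᵥ q_{uv} P(v) ⊗ G ≤ 0` for all modes `u`. -/
def StabilityLMI {m n N : ℕ} (S : PinnedNetwork m n N) (Q : Matrix (Fin N) (Fin N) ℝ)
    (p : Fin N → Fin m → ℝ) (G : Matrix (Fin n) (Fin n) ℝ) (α : ℝ) : Prop :=
  ∀ u : Fin N,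
    (-(symPart ((Matrix.diagonal (p u) *
          (α • (1 : Matrix (Fin m) (Fin m) ℝ) - S.c • S.lap u
            - (S.c * S.ε) • Matrix.diagonal (S.pin u))) ⊗ₖ (G * S.Γ))
        + (1 / 2 : ℝ) • ∑ v, Q u v • lyap p G v)).PosSemidef

/-- `σ` is a homogeneous continuous-time Markov chain, relative to the filtration `ℱ`, with state
space `Fin N`, generator `Q`, and right-continuous paths with left limits. -/
structure IsMarkovChain {N : ℕ} {Ω : Type*} [mΩ : MeasurableSpace Ω] (μ : Measure Ω)
    (ℱ : Filtration ℝ≥0 mΩ) (Q : Matrix (Fin N) (Fin N) ℝ) (σ : ℝ≥0 → Ω → Fin N) : Prop where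
  rate_nonneg : ∀ u v, u ≠ v → 0 ≤ Q u v
  row_sum : ∀ u, ∑ v, Q u v = 0
  adapted : ∀ t, Measurable[ℱ t] (σ t)
  right_continuous : ∀ ω t, ∀ᶠ r in 𝓝[>] t, σ r ω = σ t ω
  left_limit : ∀ ω t, ∃ v, ∀ᶠ r in 𝓝[<] t, σ r ω = v
  /-- There are transition probabilities `π h u v = δ_{uv} + q_{uv} h + o(h)`. -/
  markov : ∃ π : ℝ≥0 → Matrix (Fin N) (Fin N) ℝ,
    (∀ u v, (fun h : ℝ≥0 => π h u v - ((1 : Matrix (Fin N) (Fin N) ℝ) u v + Q u v * h))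
      =o[𝓝[>] 0] (fun h : ℝ≥0 => (h : ℝ))) ∧
    ∀ (t h : ℝ≥0) (A : Set Ω), MeasurableSet[ℱ t] A → ∀ u v : Fin N,
      μ.real (A ∩ {ω | σ t ω = u} ∩ {ω | σ (t + h) ω = v}) =
        μ.real (A ∩ {ω | σ t ω = u}) * π h u v

/-- The event-triggered network driven by the chain `σ`, started at `x₀`: an adapted process `x`,
with event times `T ω i k`, all paths of which follow the rule with threshold `thr`. -/
structure IsSolution {m n N : ℕ} {Ω : Type*} [mΩ : MeasurableSpace Ω]
    (ℱ : Filtration ℝ≥0 mΩ) (S : PinnedNetwork m n N) (thr : ℝ≥0 → State n → ℝ)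
    (σ : ℝ≥0 → Ω → Fin N) (x₀ : Fin m → State n)
    (x : ℝ≥0 → Ω → Fin m → State n) (T : Ω → Fin m → ℕ → ℝ≥0∞) : Prop where
  adapted : ∀ t, Measurable[ℱ t] (x t)
  initial : ∀ ω, x 0 ω = x₀
  run : ∀ ω, S.IsRun thr (fun t => σ t ω) (fun t => x t ω) (T ω)

/-- The state-dependent threshold `(β λ_min - δ λ_max / 2) / (√c λ_max) ‖e‖`. -/
def thrState {n : ℕ} (c β δ lmin lmax : ℝ) : ℝ≥0 → State n → ℝ :=
  fun _ e => (β * lmin - 1 / 2 * δ * lmax) / (Real.sqrt c * lmax) * ‖e‖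

/-- The exponentially decaying threshold `a exp(-b t)`. -/
def thrExp {n : ℕ} (a b : ℝ) : ℝ≥0 → State n → ℝ :=
  fun t _ => a * Real.exp (-b * t)

end

/-! The feedback term is a linear map of the tracking errors, bounded uniformly over the finitely
many modes. Hence the measurement error is this map applied to the displacement of the errors since
the last event. It is small shortly after an event, whatever the mode does, so a positive threshold
that is continuous in time is not exceeded at once. The same estimate near a limit point of events
excludes accumulation (`IsRun.exists_lt_next`, `IsRun.iSup_ne`). This settles the state-dependent
rule, at any node with nonzero error, and the absence of Zeno behavior for the exponential rule.

For lower bounds under the exponential rule the event times are forgotten: the errors follow the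
continuously controlled dynamics up to a disturbance of size at most `a exp(-b t)`
(`IsRun.isPerturbed`). The QUAD condition and Grönwall's inequality bound the errors on bounded time
intervals, uniformly over all paths, and continuity of `f` then bounds their speed
(`exists_err_bounds`). An inter-event interval lasts at least about threshold divided by speed,
which is a deterministic bound up to each time `R`.

For a bound uniform in time the speed must decay as fast as the threshold. If `f` is Lipschitz, the
speed over a window of fixed length is controlled by the errors at its start plus `exp(-b t)`. The
size of those errors comes from the energy `eᵀ (P(σ) ⊗ G) e / 2`: by Dynkin's formula
(`hasDerivWithinAt_integral_select`) and the matrix inequality (`energy_drift`), its mean `v`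
satisfies `v' ≤ -2 β' v + C exp(-2 b t)` with `b < β' < β`, so it is of order `exp(-2 b t)`. By
Markov's inequality the errors are of order `exp(-b t)` with probability at least `1/2`. On that
event the exponentials in threshold and speed cancel, and the factor `1/2` is all that is lost in
the expectation. -/

namespace PinnedNetwork

/-! ### Linearity of the feedback in the tracking errors -/

variable {m n N : ℕ}

/-- The tracking errors `xᵢ(t) - s(t)` of all nodes. -/
def err (S : PinnedNetwork m n N) (x : ℝ≥0 → Fin m → State n) (t : ℝ≥0) : Fin m → State n :=
  fun i => x t i - S.s t

/-- The feedback term as a continuous linear map of the tracking errors. -/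
noncomputable def feedbackMap (S : PinnedNetwork m n N) (u : Fin N) (i : Fin m) :
    (Fin m → State n) →L[ℝ] State n :=
  (∑ j, S.lap u i j • (Matrix.toEuclideanCLM (𝕜 := ℝ) S.Γ).comp
      (ContinuousLinearMap.proj (R := ℝ) (φ := fun _ : Fin m => State n) j -
        ContinuousLinearMap.proj (R := ℝ) (φ := fun _ : Fin m => State n) i)) +
    (S.ε * S.pin u i) • (Matrix.toEuclideanCLM (𝕜 := ℝ) S.Γ).comp
      (ContinuousLinearMap.proj (R := ℝ) (φ := fun _ : Fin m => State n) i)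

theorem feedback_eq_feedbackMap (S : PinnedNetwork m n N) (u : Fin N) (i : Fin m)
    (y : Fin m → State n) (w : State n) :
    S.feedback u i y w = S.feedbackMap u i (fun j => y j - w) := by
  simp [feedback, feedbackMap, act]

/-- Both feedback terms are taken in the current mode, so linearity leaves only the displacement of
the errors. Jumps of the mode change the map but create no error of their own. -/
theorem meas_eq_feedbackMap (S : PinnedNetwork m n N) (u : Fin N) (i : Fin m)
    (x : ℝ≥0 → Fin m → State n) (r t : ℝ≥0) :
    S.meas u i x r t = S.feedbackMap u i (S.err x t - S.err x r) := by
  rw [meas, feedback_eq_feedbackMap, feedback_eq_feedbackMap, map_sub]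
  rfl

theorem exists_feedbackMap_bound (S : PinnedNetwork m n N) :
    ∃ C : ℝ, 0 < C ∧ ∀ u i e, ‖S.feedbackMap u i e‖ ≤ C * ‖e‖ := by
  refine ⟨1 + ∑ u, ∑ i, ‖S.feedbackMap u i‖, by positivity, fun u i e => ?_⟩
  refine (ContinuousLinearMap.le_opNorm _ e).trans ?_
  gcongr
  have h1 : ‖S.feedbackMap u i‖ ≤ ∑ i, ‖S.feedbackMap u i‖ :=
    Finset.single_le_sum (f := fun i => ‖S.feedbackMap u i‖) (fun _ _ => norm_nonneg _)
      (Finset.mem_univ i)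
  have h2 : ∑ i, ‖S.feedbackMap u i‖ ≤ ∑ u, ∑ i, ‖S.feedbackMap u i‖ :=
    Finset.single_le_sum (f := fun u => ∑ i, ‖S.feedbackMap u i‖)
      (fun _ _ => Finset.sum_nonneg fun _ _ => norm_nonneg _) (Finset.mem_univ u)
  linarith

theorem IsTarget.continuous {S : PinnedNetwork m n N} (hs : S.IsTarget) : Continuous S.s := by
  have h : ContinuousOn (fun r : ℝ => S.s r.toNNReal) (Set.Ici 0) := fun r hr => by
    simpa [Real.coe_toNNReal r hr] using (hs r.toNNReal).continuousWithinAt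
  have h2 : Continuous (fun t : ℝ≥0 => S.s (t : ℝ).toNNReal) :=
    h.comp_continuous NNReal.continuous_coe (fun t => t.2)
  simpa using h2

theorem continuous_err {S : PinnedNetwork m n N} (hs : S.IsTarget)
    {x : ℝ≥0 → Fin m → State n} (hx : Continuous x) : Continuous (S.err x) :=
  continuous_pi fun i => ((continuous_apply i).comp hx).sub hs.continuous

/-! ### Event times along one path -/

namespace IsRun

variable {S : PinnedNetwork m n N} {thr : ℝ≥0 → State n → ℝ} {u : ℝ≥0 → Fin N}
  {x : ℝ≥0 → Fin m → State n} {T : Fin m → ℕ → ℝ≥0∞}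

theorem le_next (h : S.IsRun thr u x T) {i : Fin m} {k : ℕ} {r : ℝ≥0} (hr : T i k ≤ r)
    (hz : ∀ q : ℝ≥0, T i k ≤ q → q ≤ r →
      ‖S.meas (u q) i x (T i k).toNNReal q‖ ≤ thr q (x q i - S.s q)) :
    (r : ℝ≥0∞) ≤ T i (k + 1) := by
  rw [h.next_event i k (ne_top_of_le_ne_top ENNReal.coe_ne_top hr)]
  exact le_sSup ⟨r, rfl, hr, hz⟩

theorem meas_le (h : S.IsRun thr u x T) {i : Fin m} {k : ℕ} {q : ℝ≥0} (hq : T i k ≤ q)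
    (hq' : (q : ℝ≥0∞) < T i (k + 1)) :
    ‖S.meas (u q) i x (T i k).toNNReal q‖ ≤ thr q (x q i - S.s q) := by
  rw [h.next_event i k (ne_top_of_le_ne_top ENNReal.coe_ne_top hq), lt_sSup_iff] at hq'
  obtain ⟨τ, ⟨r, rfl, hr, hz⟩, hqr⟩ := hq'
  exact hz q hq (by exact_mod_cast hqr.le)

/-- Near a time at which the threshold is positive, no event is followed by another too soon. -/
theorem exists_lt_next (h : S.IsRun thr u x T) (hs : S.IsTarget) (i : Fin m) {t : ℝ≥0}
    (hc : ContinuousAt (fun q => thr q (x q i - S.s q)) t) (hpos : 0 < thr t (x t i - S.s t)) :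
    ∃ δ > 0, ∀ k, ∀ p : ℝ≥0, T i k = p → p ≤ t → dist p t < δ → (t : ℝ≥0∞) < T i (k + 1) := by
  obtain ⟨C, hC, hb⟩ := S.exists_feedbackMap_bound
  set g := thr t (x t i - S.s t) with hg
  have h1 : ∀ᶠ q in 𝓝 t, g / 2 < thr q (x q i - S.s q) :=
    hc.eventually_const_lt (by simpa [← hg] using hpos)
  -- Two points this close to `t` have errors at distance at most `g / (2 * C)`, hence a measurement
  -- error of at most `g / 2`, which is below the threshold nearby.
  have h2 : ∀ᶠ q in 𝓝 t, dist (S.err x q) (S.err x t) < g / (4 * C) :=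
    Metric.tendsto_nhds.1 (continuous_err hs h.continuous).continuousAt _ (by positivity)
  obtain ⟨δ, hδ, hU⟩ := Metric.eventually_nhds_iff.1 (h1.and h2)
  refine ⟨δ, hδ, fun k p hp hpt hd => ?_⟩
  have hδ' : (0 : ℝ≥0) < (δ / 2).toNNReal := Real.toNNReal_pos.2 (by positivity)
  have hδ2 : (((δ / 2).toNNReal : ℝ≥0) : ℝ) = δ / 2 := Real.coe_toNNReal _ (by positivity)
  refine lt_of_lt_of_le (b := ((t + (δ / 2).toNNReal : ℝ≥0) : ℝ≥0∞)) ?_ ?_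
  · exact_mod_cast lt_add_of_pos_right t hδ'
  · refine h.le_next ?_ fun q hq hqr => ?_
    · rw [hp]
      exact_mod_cast hpt.trans le_self_add
    · rw [hp] at hq ⊢
      have hpq : (p : ℝ) ≤ q := by exact_mod_cast hq
      have hqr' : (q : ℝ) ≤ t + δ / 2 := by rw [← hδ2]; exact_mod_cast hqr
      rw [NNReal.dist_eq, abs_lt] at hd
      have hqt : dist q t < δ := by
        rw [NNReal.dist_eq, abs_lt]
        constructor <;> linarith
      obtain ⟨ha, hb1⟩ := hU hqt
      obtain ⟨-, hb2⟩ := hU (y := p) (by rw [NNReal.dist_eq, abs_lt]; exact hd)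
      rw [ENNReal.toNNReal_coe, meas_eq_feedbackMap]
      refine (hb _ _ _).trans ?_
      rw [← dist_eq_norm]
      have h3 : dist (S.err x q) (S.err x p) ≤ g / (4 * C) + g / (4 * C) :=
        (dist_triangle_right _ _ _).trans (add_le_add hb1.le hb2.le)
      calc C * dist (S.err x q) (S.err x p) ≤ C * (g / (4 * C) + g / (4 * C)) := by gcongr
        _ = g / 2 := by field_simp; ring
        _ ≤ _ := ha.le

/-- Events do not accumulate at a time at which the threshold is positive. -/
theorem iSup_ne (h : S.IsRun thr u x T) (hs : S.IsTarget) (i : Fin m) {t : ℝ≥0}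
    (hc : ContinuousAt (fun q => thr q (x q i - S.s q)) t) (hpos : 0 < thr t (x t i - S.s t)) :
    ⨆ k, T i k ≠ t := by
  intro hT
  obtain ⟨δ, hδ, hk⟩ := h.exists_lt_next hs i hc hpos
  have hle : ∀ k, T i k ≤ t := fun k => hT ▸ le_iSup (T i) k
  obtain ⟨k, hk'⟩ : ∃ k, (t : ℝ) - δ < (T i k).toNNReal := by
    -- If `t < δ`, then `t - δ` is not a nonnegative time, but the event at time `0` is already
    -- close enough to `t`.
    by_cases htd : (t : ℝ) < δ
    · exact ⟨0, lt_of_lt_of_le (by linarith) (NNReal.coe_nonneg _)⟩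
    · have h0 : (0 : ℝ) ≤ t - δ := by linarith [not_lt.1 htd]
      have h1 : (((t - δ : ℝ).toNNReal : ℝ≥0) : ℝ≥0∞) < ⨆ k, T i k := by
        rw [hT, ENNReal.coe_lt_coe, ← NNReal.coe_lt_coe, Real.coe_toNNReal _ h0]
        linarith
      obtain ⟨k, hlt⟩ := lt_iSup_iff.1 h1
      refine ⟨k, ?_⟩
      rw [← ENNReal.coe_toNNReal (ne_top_of_le_ne_top ENNReal.coe_ne_top (hle k)),
        ENNReal.coe_lt_coe, ← NNReal.coe_lt_coe, Real.coe_toNNReal _ h0] at hlt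
      exact hlt
  have htop := ne_top_of_le_ne_top ENNReal.coe_ne_top (hle k)
  have hpt : (T i k).toNNReal ≤ t := by
    rw [← ENNReal.coe_le_coe, ENNReal.coe_toNNReal htop]
    exact hle k
  refine absurd (hle (k + 1)) (not_le.2 (hk k _ (ENNReal.coe_toNNReal htop).symm hpt ?_))
  rw [NNReal.dist_eq, abs_lt]
  have : ((T i k).toNNReal : ℝ) ≤ t := by exact_mod_cast hpt
  constructor <;> linarith

/-- If some event time exceeds `t`, then `t` is between two successive events. -/
theorem exists_between (h : S.IsRun thr u x T) {i : Fin m} {t : ℝ≥0}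
    (ht : ∃ k, (t : ℝ≥0∞) < T i k) : ∃ k, T i k ≤ t ∧ (t : ℝ≥0∞) < T i (k + 1) := by
  classical
  have hlt := Nat.find_spec ht
  have hmin := fun j => Nat.find_min ht (m := j)
  rcases hk : Nat.find ht with _ | k
  · rw [hk, h.first_event] at hlt
    exact absurd hlt not_lt_zero
  · rw [hk] at hlt
    exact ⟨k, not_lt.1 (hmin k (by omega)), hlt⟩

/-- Otherwise all events of the node occur by time `t`. A supremum before `t` contradicts operation
at that earlier time, and a supremum equal to `t` is an accumulation at a time of positive
threshold. -/
theorem exists_between_of_pos (h : S.IsRun thr u x T) (hs : S.IsTarget) (i : Fin m) {t : ℝ≥0}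
    (hA : ∀ r < t, Alive T r)
    (hc : ContinuousAt (fun q => thr q (x q i - S.s q)) t) (hpos : 0 < thr t (x t i - S.s t)) :
    ∃ k, T i k ≤ t ∧ (t : ℝ≥0∞) < T i (k + 1) := by
  refine h.exists_between ?_
  by_contra! hle
  have hsup : ⨆ k, T i k ≤ t := iSup_le hle
  rcases hsup.lt_or_eq with hlt | heq
  · lift (⨆ k, T i k) to ℝ≥0 using hlt.ne_top with r hr
    obtain ⟨l, -, hl⟩ := hA r (by exact_mod_cast hlt) i
    exact absurd (hr ▸ le_iSup (T i) (l + 1)) (not_le.2 hl)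
  · exact h.iSup_ne hs i hc hpos heq

/-- A threshold that depends continuously on time and is positive at all times. -/
theorem lt_next (h : S.IsRun thr u x T) (hs : S.IsTarget) (i : Fin m)
    (hc : Continuous (fun q => thr q (x q i - S.s q)))
    (hpos : ∀ t, 0 < thr t (x t i - S.s t)) {k : ℕ} (hk : T i k ≠ ⊤) : T i k < T i (k + 1) := by
  lift T i k to ℝ≥0 using hk with p hp
  obtain ⟨δ, hδ, hδk⟩ := h.exists_lt_next hs i hc.continuousAt (hpos p)
  exact hδk k p hp.symm le_rfl (by simpa using hδ)

theorem monotone (h : S.IsRun thr u x T) (hs : S.IsTarget) (i : Fin m)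
    (hc : Continuous (fun q => thr q (x q i - S.s q)))
    (hpos : ∀ t, 0 < thr t (x t i - S.s t)) : Monotone (T i) := by
  refine monotone_nat_of_le_succ fun k => ?_
  by_cases hk : T i k = ⊤
  · rw [hk, h.no_event i k hk]
  · exact (h.lt_next hs i hc hpos hk).le

theorem iSup_eq_top (h : S.IsRun thr u x T) (hs : S.IsTarget) (i : Fin m)
    (hc : Continuous (fun q => thr q (x q i - S.s q)))
    (hpos : ∀ t, 0 < thr t (x t i - S.s t)) : ⨆ k, T i k = ⊤ := by
  by_contra hne
  exact h.iSup_ne hs i hc.continuousAt (hpos _) (ENNReal.coe_toNNReal hne).symm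

theorem tendsto_top (h : S.IsRun thr u x T) (hs : S.IsTarget) (i : Fin m)
    (hc : Continuous (fun q => thr q (x q i - S.s q)))
    (hpos : ∀ t, 0 < thr t (x t i - S.s t)) : Tendsto (T i) atTop (𝓝 ⊤) :=
  h.iSup_eq_top hs i hc hpos ▸ tendsto_atTop_iSup (h.monotone hs i hc hpos)

theorem alive (h : S.IsRun thr u x T) (hs : S.IsTarget)
    (hc : ∀ i, Continuous (fun q => thr q (x q i - S.s q)))
    (hpos : ∀ i t, 0 < thr t (x t i - S.s t)) (t : ℝ≥0) : Alive T t := fun i => by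
  refine h.exists_between (lt_iSup_iff.1 ?_)
  rw [h.iSup_eq_top hs i (hc i) (hpos i)]
  exact ENNReal.coe_lt_top

end IsRun

/-! ### Event-triggered control as a perturbation of continuous control -/

/-- A path of the network whose tracking errors follow the continuously controlled dynamics up to
a disturbance `z` bounded by `a exp(-b t)`. -/
structure IsPerturbed (S : PinnedNetwork m n N) (a b : ℝ) (u : ℝ≥0 → Fin N)
    (x : ℝ≥0 → Fin m → State n) : Prop where
  continuous : Continuous x
  dynamics : ∀ t : ℝ≥0, ∃ z : Fin m → State n, ‖z‖ ≤ a * Real.exp (-b * t) ∧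
    HasDerivWithinAt (fun r : ℝ => S.err x r.toNNReal)
      (fun i => S.f (x t i) - S.f (S.s t) - S.c • S.feedbackMap (u t) i (S.err x t) + S.c • z i)
      (Set.Ici (t : ℝ)) (t : ℝ)

theorem continuous_thrExp (a b : ℝ) (y : ℝ≥0 → State n) :
    Continuous (fun q => thrExp a b q (y q)) := by
  unfold thrExp
  fun_prop

theorem thrExp_pos {a : ℝ} (ha : 0 < a) (b : ℝ) (t : ℝ≥0) (e : State n) :
    0 < thrExp a b t e := by
  unfold thrExp
  positivity

/-- The disturbance is the measurement error itself: the sampled feedback is the current one minus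
`zᵢ`, and between events the rule keeps `zᵢ` below the threshold. Since no accumulation occurs, this
covers all times. -/
theorem IsRun.isPerturbed {S : PinnedNetwork m n N} {a b : ℝ} {u : ℝ≥0 → Fin N}
    {x : ℝ≥0 → Fin m → State n} {T : Fin m → ℕ → ℝ≥0∞} (ha : 0 < a) (hs : S.IsTarget)
    (h : S.IsRun (thrExp a b) u x T) : S.IsPerturbed a b u x := by
  refine ⟨h.continuous, fun t => ?_⟩
  have hA := h.alive hs (fun i => continuous_thrExp a b _) (fun i t => thrExp_pos ha b t _) t
  choose k hk hk' using fun i => hA i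
  refine ⟨fun i => S.meas (u t) i x (T i (k i)).toNNReal t,
    (pi_norm_le_iff_of_nonneg (by positivity)).2 fun i => h.meas_le (hk i) (hk' i), ?_⟩
  refine hasDerivWithinAt_pi.2 fun i => ?_
  have h1 := h.dynamics t hA i (k i) (hk i) (hk' i)
  have h2 := (hs t).mono (Set.Ici_subset_Ici.2 t.2)
  refine (h1.sub h2).congr_deriv ?_
  simp only [meas, feedback_eq_feedbackMap]
  change _ = S.f (x t i) - S.f (S.s t) - S.c • S.feedbackMap (u t) i (fun j => x t j - S.s t) + _
  rw [smul_sub]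
  abel

end PinnedNetwork

/-! ### Quadratic forms -/

theorem act_eq {n : ℕ} (A : Matrix (Fin n) (Fin n) ℝ) :
    act A = Matrix.toEuclideanCLM (𝕜 := ℝ) A := rfl

theorem act_mul {n : ℕ} (A B : Matrix (Fin n) (Fin n) ℝ) (v : State n) :
    act (A * B) v = act A (act B v) := by
  simp [act]

theorem inner_act {n : ℕ} (A : Matrix (Fin n) (Fin n) ℝ) (v w : State n) :
    inner ℝ v (act A w) = ∑ k, ∑ l, v k * A k l * w l := by
  rw [act, Matrix.inner_toEuclideanCLM]
  simp only [dotProduct, Matrix.mulVec, Finset.mul_sum, mul_assoc]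

theorem inner_act_comm {n : ℕ} {G : Matrix (Fin n) (Fin n) ℝ} (hG : G.IsHermitian)
    (v w : State n) : inner ℝ v (act G w) = inner ℝ w (act G v) := by
  rw [inner_act, inner_act, Finset.sum_comm]
  refine Finset.sum_congr rfl fun k _ => Finset.sum_congr rfl fun l _ => ?_
  have : G l k = G k l := by simpa using hG.apply k l
  rw [this]
  ring

theorem exists_act_bound {n : ℕ} (A : Matrix (Fin n) (Fin n) ℝ) :
    ∃ C : ℝ, 0 < C ∧ ∀ v w : State n, |inner ℝ v (act A w)| ≤ C * (‖v‖ * ‖w‖) := by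
  refine ⟨‖Matrix.toEuclideanCLM (𝕜 := ℝ) A‖ + 1, by positivity, fun v w => ?_⟩
  have h1 := abs_real_inner_le_norm v (act A w)
  have h2 := (Matrix.toEuclideanCLM (𝕜 := ℝ) A).le_opNorm w
  rw [← act_eq] at h2
  nlinarith [norm_nonneg v, norm_nonneg w, mul_nonneg (norm_nonneg v) (norm_nonneg w),
    mul_le_mul_of_nonneg_left h2 (norm_nonneg v)]

/-- By compactness the form attains a positive minimum on the unit sphere; homogeneity does the
rest. In dimension `0` the sphere is empty. -/
theorem exists_posDef_bound {n : ℕ} {G : Matrix (Fin n) (Fin n) ℝ} (hG : G.PosDef) :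
    ∃ K : ℝ, 0 < K ∧ ∀ v : State n, ‖v‖ ^ 2 ≤ K * inner ℝ v (act G v) := by
  have hpos : ∀ v : State n, v ≠ 0 → 0 < inner ℝ v (act G v) := fun v hv => by
    have hv' : WithLp.ofLp v ≠ 0 := fun h => hv (by ext k; simpa using congrFun h k)
    have := hG.re_dotProduct_pos hv'
    rw [act, Matrix.inner_toEuclideanCLM]
    simpa using this
  have hcont : Continuous fun v : State n => inner ℝ v (act G v) := by
    rw [act_eq]
    fun_prop
  have hsphere : ∀ v : State n, v ≠ 0 → ‖v‖⁻¹ • v ∈ Metric.sphere (0 : State n) 1 := fun v hv => by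
    simp [norm_smul, hv]
  rcases (Metric.sphere (0 : State n) 1).eq_empty_or_nonempty with h | h
  · refine ⟨1, one_pos, fun v => ?_⟩
    by_cases hv : v = 0
    · simp [hv]
    · exact absurd (hsphere v hv) (by simp [h])
  · obtain ⟨w, hw, hmin⟩ := (isCompact_sphere (0 : State n) 1).exists_isMinOn h hcont.continuousOn
    have hw0 : w ≠ 0 := ne_zero_of_mem_unit_sphere (⟨w, hw⟩ : Metric.sphere (0 : State n) 1)
    have hκ := hpos w hw0
    refine ⟨(inner ℝ w (act G w))⁻¹, inv_pos.2 hκ, fun v => ?_⟩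
    by_cases hv : v = 0
    · simp [hv, act]
    · have h1 : inner ℝ w (act G w) ≤ inner ℝ (‖v‖⁻¹ • v) (act G (‖v‖⁻¹ • v)) :=
        hmin (hsphere v hv)
      have hv' : 0 < ‖v‖ := norm_pos_iff.2 hv
      simp only [act_eq, map_smul, inner_smul_left, inner_smul_right] at h1 hκ ⊢
      rw [inv_mul_eq_div, le_div_iff₀ hκ]
      calc ‖v‖ ^ 2 * _ ≤ ‖v‖ ^ 2 * _ := mul_le_mul_of_nonneg_left h1 (by positivity)
        _ = _ := by simp; field_simp

theorem inner_act_nonneg {n : ℕ} {G : Matrix (Fin n) (Fin n) ℝ} (hG : G.PosDef) (v : State n) :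
    0 ≤ inner ℝ v (act G v) := by
  obtain ⟨K, hK, h⟩ := exists_posDef_bound hG
  exact nonneg_of_mul_nonneg_right ((sq_nonneg _).trans (h v)) hK

/-- Young's inequality for the inner product defined by `G`. -/
theorem inner_act_young {n : ℕ} {G : Matrix (Fin n) (Fin n) ℝ} (hG : G.PosDef) {ρ : ℝ}
    (hρ : 0 < ρ) (v w : State n) :
    inner ℝ v (act G w) ≤ ρ / 2 * inner ℝ v (act G v) + 1 / (2 * ρ) * inner ℝ w (act G w) := by
  have h := inner_act_nonneg hG (ρ • v - w)
  have hc := inner_act_comm hG.isHermitian w v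
  simp only [act_eq, map_sub, map_smul, inner_sub_left, inner_sub_right, inner_smul_left,
    inner_smul_right, RCLike.conj_to_real] at h hc ⊢
  rw [hc] at h
  have h2 : 0 ≤ 1 / (2 * ρ) * (ρ * (ρ * inner ℝ v (Matrix.toEuclideanCLM (𝕜 := ℝ) G v)) -
      ρ * inner ℝ v (Matrix.toEuclideanCLM (𝕜 := ℝ) G w) -
      (ρ * inner ℝ v (Matrix.toEuclideanCLM (𝕜 := ℝ) G w) -
        inner ℝ w (Matrix.toEuclideanCLM (𝕜 := ℝ) G w))) := by
    refine mul_nonneg (by positivity) (le_of_le_of_eq h ?_)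
    ring
  field_simp at h2 ⊢
  linarith

/-- The weighted quadratic function `∑ᵢ wᵢ eᵢᵀ G eᵢ`. -/
noncomputable def weightedSq {m n : ℕ} (G : Matrix (Fin n) (Fin n) ℝ) (w : Fin m → ℝ)
    (e : Fin m → State n) : ℝ :=
  ∑ i, w i * inner ℝ (e i) (act G (e i))

theorem hasDerivWithinAt_weightedSq {m n : ℕ} {G : Matrix (Fin n) (Fin n) ℝ}
    (hG : G.IsHermitian) (w : Fin m → ℝ) {e : ℝ → Fin m → State n} {e' : Fin m → State n}
    {s : Set ℝ} {t : ℝ} (h : HasDerivWithinAt e e' s t) :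
    HasDerivWithinAt (fun r => weightedSq G w (e r))
      (2 * ∑ i, w i * inner ℝ (e t i) (act G (e' i))) s t := by
  unfold weightedSq
  rw [Finset.mul_sum]
  refine HasDerivWithinAt.fun_sum fun i _ => ?_
  have h1 := hasDerivWithinAt_pi.1 h i
  have h2 : HasDerivWithinAt (fun r => act G (e r i)) (act G (e' i)) s t :=
    (Matrix.toEuclideanCLM (𝕜 := ℝ) G).hasFDerivAt.comp_hasDerivWithinAt t h1
  refine ((h1.inner ℝ h2).const_mul (w i)).congr_deriv ?_
  rw [inner_act_comm hG (e' i)]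
  ring

/-- By symmetry `vᵀGv - wᵀGw = (v + w)ᵀG(v - w)`. The energy is thus Lipschitz in time wherever the
errors are bounded and Lipschitz. -/
theorem exists_weightedSq_lipschitz {m n : ℕ} {G : Matrix (Fin n) (Fin n) ℝ}
    (hG : G.IsHermitian) {ι : Type*} [Fintype ι] (w : ι → Fin m → ℝ) :
    ∃ C : ℝ, 0 < C ∧ ∀ (u : ι) (e e' : Fin m → State n),
      |weightedSq G (w u) e - weightedSq G (w u) e'| ≤ C * ((‖e‖ + ‖e'‖) * ‖e - e'‖) := by
  obtain ⟨C, hC, h⟩ := exists_act_bound G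
  refine ⟨(1 + ∑ u, ∑ i, |w u i|) * C, by positivity, fun u e e' => ?_⟩
  have h1 : ∀ i, |w u i * inner ℝ (e i) (act G (e i)) - w u i * inner ℝ (e' i) (act G (e' i))| ≤
      |w u i| * (C * ((‖e‖ + ‖e'‖) * ‖e - e'‖)) := fun i => by
    have h2 : inner ℝ (e i) (act G (e i)) - inner ℝ (e' i) (act G (e' i)) =
        inner ℝ (e i + e' i) (act G (e i - e' i)) := by
      have hc := inner_act_comm hG (e i) (e' i)
      simp only [act_eq, map_sub, inner_add_left, inner_sub_right] at hc ⊢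
      linarith
    rw [← mul_sub, abs_mul, h2]
    gcongr
    refine (h _ _).trans ?_
    gcongr
    · exact (norm_add_le _ _).trans (add_le_add (norm_le_pi_norm e i) (norm_le_pi_norm e' i))
    · exact norm_le_pi_norm (e - e') i
  unfold weightedSq
  rw [← Finset.sum_sub_distrib]
  refine (Finset.abs_sum_le_sum_abs _ _).trans ((Finset.sum_le_sum fun i _ => h1 i).trans ?_)
  rw [← Finset.sum_mul, mul_assoc (1 + _)]
  gcongr
  have h2 : ∑ i, |w u i| ≤ ∑ u, ∑ i, |w u i| :=
    Finset.single_le_sum (f := fun u => ∑ i, |w u i|)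
      (fun _ _ => Finset.sum_nonneg fun _ _ => abs_nonneg _) (Finset.mem_univ u)
  linarith

theorem exists_weightedSq_le {m n : ℕ} {G : Matrix (Fin n) (Fin n) ℝ}
    (hG : G.IsHermitian) {ι : Type*} [Fintype ι] (w : ι → Fin m → ℝ) :
    ∃ C : ℝ, 0 < C ∧ ∀ (u : ι) (e : Fin m → State n), weightedSq G (w u) e ≤ C * ‖e‖ ^ 2 := by
  obtain ⟨C, hC, h⟩ := exists_weightedSq_lipschitz hG w
  refine ⟨C, hC, fun u e => (le_abs_self _).trans ?_⟩
  simpa [weightedSq, sq] using h u e 0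

theorem exists_norm_sq_le_weightedSq {m n : ℕ} {G : Matrix (Fin n) (Fin n) ℝ}
    (hG : G.PosDef) {ι : Type*} [Fintype ι] {w : ι → Fin m → ℝ} (hw : ∀ u i, 0 < w u i) :
    ∃ K : ℝ, 0 < K ∧ ∀ (u : ι) (e : Fin m → State n), ‖e‖ ^ 2 ≤ K * weightedSq G (w u) e := by
  obtain ⟨K, hK, h⟩ := exists_posDef_bound hG
  have hw' : ∀ u i, 0 < (w u i)⁻¹ := fun u i => inv_pos.2 (hw u i)
  have hS : 0 ≤ ∑ u, ∑ i, (w u i)⁻¹ :=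
    Finset.sum_nonneg fun u _ => Finset.sum_nonneg fun i _ => (hw' u i).le
  refine ⟨K * (1 + ∑ u, ∑ i, (w u i)⁻¹), by positivity, fun u e => ?_⟩
  have hterm : ∀ i, 0 ≤ w u i * inner ℝ (e i) (act G (e i)) := fun i =>
    mul_nonneg (hw u i).le (inner_act_nonneg hG _)
  have hnn : 0 ≤ weightedSq G (w u) e := Finset.sum_nonneg fun i _ => hterm i
  refine (Real.le_sqrt (norm_nonneg _) (by positivity)).1 ?_
  refine (pi_norm_le_iff_of_nonneg (Real.sqrt_nonneg _)).2 fun i => ?_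
  refine (Real.le_sqrt (norm_nonneg _) (by positivity)).2 ((h (e i)).trans ?_)
  have h1 : inner ℝ (e i) (act G (e i)) = (w u i)⁻¹ * (w u i * inner ℝ (e i) (act G (e i))) := by
    rw [inv_mul_cancel_left₀ (hw u i).ne']
  have h2 : w u i * inner ℝ (e i) (act G (e i)) ≤ weightedSq G (w u) e :=
    Finset.single_le_sum (f := fun i => w u i * inner ℝ (e i) (act G (e i)))
      (fun i _ => hterm i) (Finset.mem_univ i)
  have h3 : (w u i)⁻¹ ≤ 1 + ∑ u, ∑ i, (w u i)⁻¹ := by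
    have h4 : (w u i)⁻¹ ≤ ∑ i, (w u i)⁻¹ :=
      Finset.single_le_sum (f := fun i => (w u i)⁻¹) (fun i _ => (hw' u i).le) (Finset.mem_univ i)
    have h5 : ∑ i, (w u i)⁻¹ ≤ ∑ u, ∑ i, (w u i)⁻¹ :=
      Finset.single_le_sum (f := fun u => ∑ i, (w u i)⁻¹)
        (fun u _ => Finset.sum_nonneg fun i _ => (hw' u i).le) (Finset.mem_univ u)
    linarith
  rw [h1, mul_assoc]
  gcongr
  exact hterm i

/-! ### The matrix inequality and the drift of the energy -/

/-- The quadratic function `eᵀ (P(u) ⊗ G) e / 2`. -/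
noncomputable def energy {m n N : ℕ} (p : Fin N → Fin m → ℝ) (G : Matrix (Fin n) (Fin n) ℝ)
    (u : Fin N) (e : Fin m → State n) : ℝ :=
  1 / 2 * weightedSq G (p u) e

theorem dotProduct_kronecker_mulVec {m n : ℕ} (A : Matrix (Fin m) (Fin m) ℝ)
    (B : Matrix (Fin n) (Fin n) ℝ) (e : Fin m → State n) :
    (fun q : Fin m × Fin n => e q.1 q.2) ⬝ᵥ (A ⊗ₖ B).mulVec (fun q => e q.1 q.2) =
      ∑ i, ∑ j, A i j * inner ℝ (e i) (act B (e j)) := by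
  simp only [dotProduct, Matrix.mulVec, Fintype.sum_prod_type, inner_act, Finset.mul_sum,
    Matrix.kroneckerMap_apply]
  refine Finset.sum_congr rfl fun i _ => ?_
  rw [Finset.sum_comm]
  refine Finset.sum_congr rfl fun j _ => Finset.sum_congr rfl fun k _ =>
    Finset.sum_congr rfl fun l _ => ?_
  ring

theorem dotProduct_symPart_mulVec {ι : Type*} [Fintype ι] (M : Matrix ι ι ℝ) (v : ι → ℝ) :
    v ⬝ᵥ (symPart M).mulVec v = v ⬝ᵥ M.mulVec v := by
  have : v ⬝ᵥ M.transpose.mulVec v = v ⬝ᵥ M.mulVec v := by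
    rw [Matrix.mulVec_transpose, dotProduct_comm, Matrix.dotProduct_mulVec]
  rw [symPart, Matrix.smul_mulVec, dotProduct_smul, Matrix.add_mulVec, dotProduct_add, this,
    smul_eq_mul]
  ring

theorem dotProduct_lyap_mulVec {m n N : ℕ} (p : Fin N → Fin m → ℝ)
    (G : Matrix (Fin n) (Fin n) ℝ) (u : Fin N) (e : Fin m → State n) :
    (fun q : Fin m × Fin n => e q.1 q.2) ⬝ᵥ (lyap p G u).mulVec (fun q => e q.1 q.2) =
      2 * energy p G u e := by
  rw [lyap, dotProduct_kronecker_mulVec, energy, weightedSq, ← mul_assoc]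
  norm_num [Matrix.diagonal_apply, ite_mul]

namespace PinnedNetwork

variable {m n N : ℕ}

/-- The rows of a Laplacian sum to zero, so the terms `-eᵢ` in the differences drop out and the
matrix entries of the inequality appear. -/
theorem feedbackMap_apply (S : PinnedNetwork m n N) (u : Fin N) (i : Fin m)
    (e : Fin m → State n) :
    S.feedbackMap u i e = (∑ j, S.lap u i j • act S.Γ (e j)) +
      (S.ε * S.pin u i) • act S.Γ (e i) := by
  classical
  have h0 : ∑ j, S.lap u i j = 0 := by
    have := congrFun ((S.graph u).lapMatrix_mulVec_const_eq_zero (R := ℝ)) i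
    simp only [Matrix.mulVec, dotProduct, mul_one, Pi.zero_apply] at this
    rw [← this]
    unfold lap
    congr!
  simp only [feedbackMap, act_eq]
  simp [smul_sub, Finset.sum_sub_distrib, ← Finset.sum_smul, h0]

/-- The quadratic form of the matrix inequality. -/
theorem lmi_energy {S : PinnedNetwork m n N} {Q : Matrix (Fin N) (Fin N) ℝ}
    {p : Fin N → Fin m → ℝ} {G : Matrix (Fin n) (Fin n) ℝ} {α : ℝ} (h : StabilityLMI S Q p G α)
    (u : Fin N) (e : Fin m → State n) :
    ∑ i, p u i * (α * inner ℝ (e i) (act G (act S.Γ (e i))) -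
      S.c * inner ℝ (e i) (act G (S.feedbackMap u i e))) + ∑ v, Q u v * energy p G v e ≤ 0 := by
  have h1 := (h u).re_dotProduct_nonneg (fun q : Fin m × Fin n => e q.1 q.2)
  simp only [star_trivial, RCLike.re_to_real, Matrix.neg_mulVec, dotProduct_neg,
    Matrix.add_mulVec, dotProduct_add, dotProduct_symPart_mulVec, dotProduct_kronecker_mulVec,
    Matrix.smul_mulVec, dotProduct_smul, smul_eq_mul, Matrix.sum_mulVec, dotProduct_sum,
    dotProduct_lyap_mulVec] at h1
  have h2 : ∑ i, p u i * (α * inner ℝ (e i) (act G (act S.Γ (e i))) -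
      S.c * inner ℝ (e i) (act G (S.feedbackMap u i e))) =
      ∑ i, ∑ j, (Matrix.diagonal (p u) * (α • (1 : Matrix (Fin m) (Fin m) ℝ) - S.c • S.lap u
        - (S.c * S.ε) • Matrix.diagonal (S.pin u))) i j *
          inner ℝ (e i) (act (G * S.Γ) (e j)) := by
    refine Finset.sum_congr rfl fun i _ => ?_
    simp only [Matrix.diagonal_mul, Matrix.sub_apply, Matrix.smul_apply, Matrix.one_apply,
      Matrix.diagonal_apply, feedbackMap_apply, act_mul, smul_eq_mul, mul_assoc,
      ← Finset.mul_sum]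
    congr 1
    simp only [act_eq, map_add, map_sum, map_smul, inner_add_right, inner_sum, inner_smul_right,
      sub_mul, Finset.sum_sub_distrib, mul_assoc, ← Finset.mul_sum, ite_mul, mul_ite, mul_zero,
      zero_mul, mul_one, Finset.sum_ite_eq, Finset.mem_univ, if_true]
    ring
  have h3 : (1 / 2 : ℝ) * ∑ v, Q u v * (2 * energy p G v e) = ∑ v, Q u v * energy p G v e := by
    rw [Finset.mul_sum]
    exact Finset.sum_congr rfl fun v _ => by ring
  rw [h2, ← h3]
  linarith

/-- Only exponential growth is claimed here, so the weights can be `1`: unlike the energy, this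
function does not jump with the mode and can be followed along a single path. The QUAD condition
bounds the term in `f` from one side, with no Lipschitz constant. -/
theorem weightedSq_growth {S : PinnedNetwork m n N} {G : Matrix (Fin n) (Fin n) ℝ} {α β : ℝ}
    (hc : 0 < S.c) (hα : 0 < α) (hβ : 0 < β) (hG : G.PosDef) (hf : IsQUAD S.f G S.Γ α β) :
    ∃ C : ℝ, 0 < C ∧ ∀ (u : Fin N) (ξ : Fin m → State n) (ζ : State n) (e z : Fin m → State n),
      (∀ i, e i = ξ i - ζ) →
      2 * ∑ i, 1 * inner ℝ (e i)
        (act G (S.f (ξ i) - S.f ζ - S.c • S.feedbackMap u i e + S.c • z i)) ≤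
        C * (weightedSq G (fun _ => 1) e + ‖z‖ ^ 2) := by
  obtain ⟨C₁, hC₁, h₁⟩ := exists_act_bound (G * S.Γ)
  obtain ⟨C₂, hC₂, h₂⟩ := exists_act_bound G
  obtain ⟨C₃, hC₃, h₃⟩ := S.exists_feedbackMap_bound
  obtain ⟨K, hK, h₄⟩ := exists_norm_sq_le_weightedSq (m := m) hG (ι := Unit)
    (w := fun _ _ => 1) (fun _ _ => one_pos)
  set D := α * C₁ + S.c * (C₂ * C₃) + S.c * C₂ with hD
  have hDpos : 0 < D := by positivity
  refine ⟨2 * (m * D) * (K + 1) + 1, by positivity, fun u ξ ζ e z he => ?_⟩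
  have hW : 0 ≤ weightedSq G (fun _ => 1) e :=
    nonneg_of_mul_nonneg_right ((sq_nonneg _).trans (h₄ () e)) hK
  have hterm : ∀ i, 1 * inner ℝ (e i)
      (act G (S.f (ξ i) - S.f ζ - S.c • S.feedbackMap u i e + S.c • z i)) ≤
      D * (‖e‖ ^ 2 + ‖z‖ ^ 2) := fun i => by
    have hq := hf.2 (ξ i) ζ
    have h1 := (abs_le.1 (h₁ (e i) (e i))).2
    have h2 := (abs_le.1 (h₂ (e i) (S.feedbackMap u i e))).1
    have h3 := (abs_le.1 (h₂ (e i) (z i))).2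
    have h5 := inner_act_nonneg hG (e i)
    have hei := norm_le_pi_norm e i
    have hzi := norm_le_pi_norm z i
    rw [act_mul] at h1
    rw [← he] at hq
    simp only [act_eq, map_sub, map_add, map_smul, inner_sub_right, inner_add_right,
      inner_smul_right] at hq h1 h2 h3 h5 ⊢
    have h6 : ‖e i‖ * ‖e i‖ ≤ ‖e‖ ^ 2 + ‖z‖ ^ 2 := by
      nlinarith [norm_nonneg (e i), sq_nonneg ‖z‖]
    have h7 : ‖e i‖ * ‖S.feedbackMap u i e‖ ≤ C₃ * (‖e‖ ^ 2 + ‖z‖ ^ 2) := by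
      calc ‖e i‖ * ‖S.feedbackMap u i e‖ ≤ ‖e‖ * (C₃ * ‖e‖) :=
            mul_le_mul hei (h₃ u i e) (norm_nonneg _) (norm_nonneg _)
        _ = C₃ * ‖e‖ ^ 2 := by ring
        _ ≤ _ := by gcongr; linarith [sq_nonneg ‖z‖]
    have h8 : ‖e i‖ * ‖z i‖ ≤ ‖e‖ ^ 2 + ‖z‖ ^ 2 := by
      calc ‖e i‖ * ‖z i‖ ≤ ‖e‖ * ‖z‖ := mul_le_mul hei hzi (norm_nonneg _) (norm_nonneg _)
        _ ≤ _ := by nlinarith [sq_nonneg (‖e‖ - ‖z‖), sq_nonneg (‖e‖ + ‖z‖)]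
    have h1' := h1.trans (mul_le_mul_of_nonneg_left h6 hC₁.le)
    have h2' := (neg_le_neg (mul_le_mul_of_nonneg_left h7 hC₂.le)).trans h2
    have h3' := h3.trans (mul_le_mul_of_nonneg_left h8 hC₂.le)
    have h1'' := mul_le_mul_of_nonneg_left h1' hα.le
    have h2'' := mul_le_mul_of_nonneg_left h2' hc.le
    have h3'' := mul_le_mul_of_nonneg_left h3' hc.le
    have h5' := mul_nonneg hβ.le h5
    rw [hD]
    linarith
  have hsum := Finset.sum_le_sum fun i (_ : i ∈ Finset.univ) => hterm i
  rw [Finset.sum_const, Finset.card_univ, Fintype.card_fin, nsmul_eq_mul] at hsum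
  have hmD : 0 ≤ (m : ℝ) * D := by positivity
  have h9 : ‖e‖ ^ 2 + ‖z‖ ^ 2 ≤ (K + 1) * (weightedSq G (fun _ => 1) e + ‖z‖ ^ 2) := by
    nlinarith [h₄ () e, sq_nonneg ‖z‖, mul_nonneg hK.le (sq_nonneg ‖z‖)]
  have h10 := mul_le_mul_of_nonneg_left h9 hmD
  nlinarith [add_nonneg hW (sq_nonneg ‖z‖)]

/-- The drift of the energy along the chain and the network is negative up to the disturbance. -/
theorem energy_drift {S : PinnedNetwork m n N} {Q : Matrix (Fin N) (Fin N) ℝ}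
    {p : Fin N → Fin m → ℝ} {G : Matrix (Fin n) (Fin n) ℝ} {α β β' : ℝ}
    (hβ' : β' < β) (hG : G.PosDef) (hp : ∀ u i, 0 < p u i)
    (hf : IsQUAD S.f G S.Γ α β) (hLMI : StabilityLMI S Q p G α) :
    ∃ C : ℝ, 0 < C ∧ ∀ (u : Fin N) (ξ : Fin m → State n) (ζ : State n) (e z : Fin m → State n),
      (∀ i, e i = ξ i - ζ) →
      ∑ i, p u i * inner ℝ (e i)
        (act G (S.f (ξ i) - S.f ζ - S.c • S.feedbackMap u i e + S.c • z i)) +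
        ∑ v, Q u v * energy p G v e ≤ -(2 * β') * energy p G u e + C * ‖z‖ ^ 2 := by
  obtain ⟨C, hC, hb⟩ := exists_weightedSq_le (m := m) hG.isHermitian p
  -- With this `ρ`, Young's inequality charges exactly `(β - β') eᵢᵀ G eᵢ` for the cross term with
  -- the disturbance, and the decay rate `β` drops to `β'`.
  have hρ : 0 < 2 * (β - β') := by linarith
  refine ⟨S.c ^ 2 * (1 / (2 * (2 * (β - β')))) * C + 1, by positivity, fun u ξ ζ e z he => ?_⟩
  have hl := lmi_energy hLMI u e
  have hterm : ∀ i, p u i * inner ℝ (e i)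
      (act G (S.f (ξ i) - S.f ζ - S.c • S.feedbackMap u i e + S.c • z i)) ≤
      p u i * (α * inner ℝ (e i) (act G (act S.Γ (e i))) -
        S.c * inner ℝ (e i) (act G (S.feedbackMap u i e))) -
      β' * (p u i * inner ℝ (e i) (act G (e i))) +
      S.c ^ 2 * (1 / (2 * (2 * (β - β')))) * (p u i * inner ℝ (z i) (act G (z i))) := fun i => by
    have hq := hf.2 (ξ i) ζ
    have hy := inner_act_young hG hρ (e i) (S.c • z i)
    rw [← he] at hq
    simp only [act_eq, map_sub, map_add, map_smul, inner_sub_right, inner_add_right,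
      inner_smul_right, inner_smul_left, RCLike.conj_to_real] at hq hy ⊢
    have := mul_le_mul_of_nonneg_left (add_le_add hq hy) (hp u i).le
    linarith
  have hsum := Finset.sum_le_sum fun i (_ : i ∈ Finset.univ) => hterm i
  simp only [Finset.sum_add_distrib, Finset.sum_sub_distrib, ← Finset.mul_sum] at hsum
  have hz := mul_le_mul_of_nonneg_left (hb u z)
    (by positivity : 0 ≤ S.c ^ 2 * (1 / (2 * (2 * (β - β')))))
  have he2 : energy p G u e = 1 / 2 * ∑ i, p u i * inner ℝ (e i) (act G (e i)) := rfl
  unfold weightedSq at hz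
  rw [he2]
  nlinarith [sq_nonneg ‖z‖]

end PinnedNetwork

/-! ### Size and speed of the errors, uniformly over paths -/

namespace PinnedNetwork

variable {m n N : ℕ}

namespace IsPerturbed

variable {S : PinnedNetwork m n N} {a b : ℝ} {u : ℝ≥0 → Fin N} {x : ℝ≥0 → Fin m → State n}

theorem continuous_err (h : S.IsPerturbed a b u x) (hs : S.IsTarget) :
    Continuous fun r : ℝ => S.err x r.toNNReal :=
  (PinnedNetwork.continuous_err hs h.continuous).comp continuous_real_toNNReal

end IsPerturbed

/-- Grönwall's inequality on a window of length `L`. After `t₀` the disturbance is at most `a exp(-b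
t₀)`, so the constant depends neither on `t₀` nor on the path; this scaling is what the time-uniform
bound rests on. -/
theorem exists_norm_err_growth {S : PinnedNetwork m n N} {G : Matrix (Fin n) (Fin n) ℝ}
    {α β a b : ℝ} (hc : 0 < S.c) (hα : 0 < α) (hβ : 0 < β) (hG : G.PosDef)
    (hf : IsQUAD S.f G S.Γ α β) (hs : S.IsTarget) (hb : 0 ≤ b) (L : ℝ) :
    ∃ K : ℝ, 0 < K ∧ ∀ (u : ℝ≥0 → Fin N) (x : ℝ≥0 → Fin m → State n), S.IsPerturbed a b u x →
      ∀ t₀ t : ℝ≥0, t₀ ≤ t → (t : ℝ) ≤ t₀ + L →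
        ‖S.err x t‖ ≤ K * (‖S.err x t₀‖ + Real.exp (-b * t₀)) := by
  obtain ⟨C, hC, hgrow⟩ := weightedSq_growth (m := m) hc hα hβ hG hf
  obtain ⟨C₁, hC₁, hle⟩ := exists_weightedSq_le (m := m) hG.isHermitian (fun (_ : Unit) _ => 1)
  obtain ⟨K₀, hK₀, hge⟩ := exists_norm_sq_le_weightedSq (m := m) hG
    (w := fun (_ : Unit) _ => 1) (fun _ _ => one_pos)
  set B : ℝ := K₀ * ((C₁ + a ^ 2) * Real.exp (C * L)) with hB
  have hBpos : 0 < B := by positivity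
  refine ⟨Real.sqrt B, Real.sqrt_pos.2 hBpos, fun u x hx t₀ t ht htL => ?_⟩
  set E := Real.exp (-b * t₀) with hE
  have hEpos : 0 < E := Real.exp_pos _
  set W : ℝ → ℝ := fun r => weightedSq G (fun _ => 1) (S.err x r.toNNReal) with hW
  choose z hz hd using hx.dynamics
  have hdW : ∀ r ∈ Set.Ico (t₀ : ℝ) t, HasDerivWithinAt W
      (2 * ∑ i, 1 * inner ℝ (S.err x r.toNNReal i) (act G
        (S.f (x r.toNNReal i) - S.f (S.s r.toNNReal) -
          S.c • S.feedbackMap (u r.toNNReal) i (S.err x r.toNNReal) + S.c • z r.toNNReal i)))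
      (Set.Ici r) r := fun r hr => by
    have h0 : 0 ≤ r := t₀.2.trans hr.1
    have h1 := hd r.toNNReal
    rw [Real.coe_toNNReal r h0] at h1
    exact hasDerivWithinAt_weightedSq hG.isHermitian _ h1
  have hcont : ContinuousOn W (Set.Icc (t₀ : ℝ) t) := by
    have h1 := hx.continuous_err hs
    refine Continuous.continuousOn ?_
    simp only [hW, weightedSq, act_eq]
    fun_prop
  -- This form of Grönwall's inequality needs right derivatives only, which is all there is at jumps
  -- of the mode and at events.
  have hbound := le_gronwallBound_of_liminf_deriv_right_le (δ := W t₀) (K := C)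
    (ε := C * (a ^ 2 * E ^ 2)) hcont (fun r hr c hc => (hdW r hr).liminf_right_slope_le hc) le_rfl
    (fun r hr => by
      refine (hgrow _ _ _ _ _ fun i => rfl).trans ?_
      rw [mul_add]
      have h0 : 0 ≤ r := t₀.2.trans hr.1
      have h1 : ‖z r.toNNReal‖ ≤ a * E := by
        have ha : 0 ≤ a := nonneg_of_mul_nonneg_left ((norm_nonneg _).trans (hz 0))
          (Real.exp_pos _)
        refine (hz _).trans ?_
        rw [Real.coe_toNNReal r h0]
        have := hr.1
        gcongr _ * ?_
        exact Real.exp_le_exp.2 (by nlinarith)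
      have h2 := pow_le_pow_left₀ (norm_nonneg _) h1 2
      rw [mul_pow] at h2
      exact add_le_add le_rfl (mul_le_mul_of_nonneg_left h2 hC.le)) t ⟨by exact_mod_cast ht, le_rfl⟩
  rw [gronwallBound_of_K_ne_0 hC.ne', mul_div_cancel_left₀ _ hC.ne'] at hbound
  simp only [hW, Real.toNNReal_coe] at hbound
  have hexp : Real.exp (C * (t - t₀)) ≤ Real.exp (C * L) :=
    Real.exp_le_exp.2 (mul_le_mul_of_nonneg_left (by linarith) hC.le)
  have hfin : ‖S.err x t‖ ^ 2 ≤ B * (‖S.err x t₀‖ + E) ^ 2 := by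
    refine (hge () _).trans ?_
    rw [hB, mul_assoc]
    refine mul_le_mul_of_nonneg_left (hbound.trans ?_) hK₀.le
    have h1 := hle () (S.err x t₀)
    have h2 : weightedSq G (fun _ => 1) (S.err x t₀) + a ^ 2 * E ^ 2 ≤
        (C₁ + a ^ 2) * (‖S.err x t₀‖ + E) ^ 2 := by
      nlinarith [norm_nonneg (S.err x t₀), mul_nonneg (norm_nonneg (S.err x t₀)) hEpos.le,
        mul_nonneg hC₁.le (mul_nonneg (norm_nonneg (S.err x t₀)) hEpos.le),
        mul_nonneg (sq_nonneg a) (mul_nonneg (norm_nonneg (S.err x t₀)) hEpos.le),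
        mul_nonneg hC₁.le (sq_nonneg E), mul_nonneg (sq_nonneg a) (sq_nonneg ‖S.err x t₀‖)]
    have h3 : 0 ≤ weightedSq G (fun _ => 1) (S.err x t₀) :=
      nonneg_of_mul_nonneg_right ((sq_nonneg _).trans (hge () _)) hK₀
    have h4 : 0 ≤ a ^ 2 * E ^ 2 := by positivity
    calc _ ≤ (weightedSq G (fun _ => 1) (S.err x t₀) + a ^ 2 * E ^ 2) *
          Real.exp (C * (t - t₀)) := by nlinarith
      _ ≤ ((C₁ + a ^ 2) * (‖S.err x t₀‖ + E) ^ 2) * Real.exp (C * L) := by gcongr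
      _ = _ := by ring
  rw [← Real.sqrt_sq (norm_nonneg (S.err x t))]
  refine (Real.sqrt_le_sqrt hfin).trans ?_
  rw [Real.sqrt_mul hBpos.le, Real.sqrt_sq (by positivity)]

/-- The mean value inequality for right derivatives. The bound `F` on the increments of `f` is left
open: it comes from compactness in one application and from a Lipschitz constant in the other. -/
theorem exists_err_lipschitz (S : PinnedNetwork m n N) {a b : ℝ} (hc : 0 < S.c)
    (hs : S.IsTarget) (hb : 0 ≤ b) :
    ∃ C : ℝ, 0 < C ∧ ∀ (u : ℝ≥0 → Fin N) (x : ℝ≥0 → Fin m → State n), S.IsPerturbed a b u x →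
      ∀ (t₀ t₁ : ℝ≥0) (F : ℝ),
        (∀ t, t₀ ≤ t → t ≤ t₁ → (∀ i, ‖S.f (x t i) - S.f (S.s t)‖ ≤ F) ∧ ‖S.err x t‖ ≤ F) →
        ∀ q r : ℝ≥0, t₀ ≤ q → q ≤ r → r ≤ t₁ →
          ‖S.err x r - S.err x q‖ ≤ C * (F + Real.exp (-b * t₀)) * (r - q) := by
  obtain ⟨C₃, hC₃, hφ⟩ := S.exists_feedbackMap_bound
  refine ⟨1 + S.c * C₃ + S.c * |a|, by positivity, fun u x hx t₀ t₁ F hF q r hq hqr hr => ?_⟩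
  choose z hz hd using hx.dynamics
  have hF0 : 0 ≤ F := (norm_nonneg _).trans (hF q hq (hqr.trans hr)).2
  have h := norm_image_sub_le_of_norm_deriv_right_le_segment
    (f := fun r : ℝ => S.err x r.toNNReal) (a := q) (b := r)
    (f' := fun t i => S.f (x t.toNNReal i) - S.f (S.s t.toNNReal) -
      S.c • S.feedbackMap (u t.toNNReal) i (S.err x t.toNNReal) + S.c • z t.toNNReal i)
    (C := (1 + S.c * C₃ + S.c * |a|) * (F + Real.exp (-b * t₀)))
    (hx.continuous_err hs).continuousOn
    (fun t ht => by
      have h0 : 0 ≤ t := q.2.trans ht.1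
      have h1 := hd t.toNNReal
      rwa [Real.coe_toNNReal t h0] at h1)
    (fun t ht => by
      have h0 : 0 ≤ t := q.2.trans ht.1
      have ht1 : t₀ ≤ t.toNNReal := hq.trans (NNReal.le_toNNReal_of_coe_le ht.1)
      have ht2 : t.toNNReal ≤ t₁ := (Real.toNNReal_le_iff_le_coe.2 ht.2.le).trans hr
      have ht3 : (t₀ : ℝ) ≤ t := le_trans (by exact_mod_cast hq) ht.1
      obtain ⟨hf, he⟩ := hF _ ht1 ht2
      refine (pi_norm_le_iff_of_nonneg (by positivity)).2 fun i => ?_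
      have hz' : ‖z t.toNNReal i‖ ≤ |a| * Real.exp (-b * t₀) := by
        refine (norm_le_pi_norm _ i).trans ((hz _).trans ?_)
        rw [Real.coe_toNNReal t h0]
        refine mul_le_mul (le_abs_self a) (Real.exp_le_exp.2 (by nlinarith))
          (Real.exp_pos _).le (abs_nonneg a)
      have hφ' : ‖S.feedbackMap (u t.toNNReal) i (S.err x t.toNNReal)‖ ≤ C₃ * F :=
        (hφ _ _ _).trans (by gcongr)
      refine (norm_add_le _ _).trans ((add_le_add (norm_sub_le _ _) le_rfl).trans ?_)
      rw [norm_smul, norm_smul, Real.norm_of_nonneg hc.le]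
      have h4 := mul_le_mul_of_nonneg_left hz' hc.le
      have h5 := mul_le_mul_of_nonneg_left hφ' hc.le
      have h6 := Real.exp_pos (-b * t₀)
      have h7 : 0 ≤ S.c * C₃ * Real.exp (-b * t₀) := by positivity
      have h8 : 0 ≤ S.c * |a| * F := by positivity
      have h9 := hf i
      nlinarith)
    r ⟨by exact_mod_cast hqr, le_rfl⟩
  simpa using h

/-- Uniform bounds on compact time intervals for all paths with the same initial state. -/
theorem exists_err_bounds {S : PinnedNetwork m n N} {G : Matrix (Fin n) (Fin n) ℝ}
    {α β a b : ℝ} (hc : 0 < S.c) (hα : 0 < α) (hβ : 0 < β) (hG : G.PosDef)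
    (hf : IsQUAD S.f G S.Γ α β) (hs : S.IsTarget) (hb : 0 ≤ b) (x₀ : Fin m → State n) (R : ℝ≥0) :
    ∃ M : ℝ, 0 < M ∧ ∀ (u : ℝ≥0 → Fin N) (x : ℝ≥0 → Fin m → State n), S.IsPerturbed a b u x →
      x 0 = x₀ → (∀ t ≤ R, ‖S.err x t‖ ≤ M) ∧
        ∀ q r : ℝ≥0, q ≤ r → r ≤ R → ‖S.err x r - S.err x q‖ ≤ M * (r - q) := by
  obtain ⟨K, hK, hgrow⟩ := exists_norm_err_growth (m := m) (a := a) hc hα hβ hG hf hs hb R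
  obtain ⟨C, hC, hlip⟩ := exists_err_lipschitz S (a := a) hc hs hb
  set M₁ := K * (‖fun i => x₀ i - S.s 0‖ + 1) with hM₁
  have hM₁pos : 0 < M₁ := by positivity
  have herr : ∀ (u : ℝ≥0 → Fin N) (x : ℝ≥0 → Fin m → State n), S.IsPerturbed a b u x →
      x 0 = x₀ → ∀ t ≤ R, ‖S.err x t‖ ≤ M₁ := fun u x hx hx0 t ht => by
    have h := hgrow u x hx 0 t zero_le (by simpa using ht)
    have h0 : S.err x 0 = fun i => x₀ i - S.s 0 := by rw [← hx0]; rfl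
    simpa [h0, hM₁] using h
  obtain ⟨B, hB⟩ := (isCompact_Icc (a := (0 : ℝ≥0)) (b := R)).exists_bound_of_continuousOn
    hs.continuous.continuousOn
  -- All node states and the target remain in this ball up to time `R`, so continuity of `f`
  -- suffices.
  obtain ⟨F, hF⟩ := (isCompact_closedBall (0 : State n) (M₁ + B)).exists_bound_of_continuousOn
    hf.1.continuousOn
  refine ⟨M₁ + C * (max M₁ (2 * F) + 1), by positivity, fun u x hx hx0 => ⟨fun t ht => ?_,
    fun q r hqr hr => ?_⟩⟩
  · exact (herr u x hx hx0 t ht).trans (le_add_of_nonneg_right (by positivity))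
  · refine (hlip u x hx 0 R (max M₁ (2 * F)) (fun t _ ht => ⟨fun i => ?_, ?_⟩) q r zero_le
      hqr hr).trans ?_
    · have h1 := herr u x hx hx0 t ht
      have h2 := hB t ⟨zero_le, ht⟩
      have h3 : ‖x t i‖ ≤ M₁ + B := by
        have h4 : ‖x t i - S.s t‖ ≤ M₁ := (norm_le_pi_norm (S.err x t) i).trans h1
        have h5 := norm_add_le (x t i - S.s t) (S.s t)
        rw [sub_add_cancel] at h5
        linarith
      have h6 := hF (x t i) (by simpa using h3)
      have h7 := hF (S.s t) (by simpa using h2.trans (by linarith))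
      refine (norm_sub_le _ _).trans (le_trans ?_ (le_max_right _ _))
      linarith
    · exact (herr u x hx hx0 t ht).trans (le_max_left _ _)
    · have h1 : (q : ℝ) ≤ r := by exact_mod_cast hqr
      refine mul_le_mul_of_nonneg_right ?_ (by linarith)
      simp only [NNReal.coe_zero, mul_zero, Real.exp_zero]
      linarith

/-- For globally Lipschitz `f`, the speed of the errors is controlled by their initial size. -/
theorem exists_err_lipschitz_of_lipschitz {S : PinnedNetwork m n N}
    {G : Matrix (Fin n) (Fin n) ℝ}
    {α β a b : ℝ} (hc : 0 < S.c) (hα : 0 < α) (hβ : 0 < β) (hG : G.PosDef)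
    (hf : IsQUAD S.f G S.Γ α β) (hs : S.IsTarget) (hb : 0 ≤ b) {Kf : ℝ≥0}
    (hlf : LipschitzWith Kf S.f) (L : ℝ≥0) :
    ∃ K : ℝ, 0 < K ∧ ∀ (u : ℝ≥0 → Fin N) (x : ℝ≥0 → Fin m → State n), S.IsPerturbed a b u x →
      ∀ t₀ q r : ℝ≥0, t₀ ≤ q → q ≤ r → r ≤ t₀ + L →
        ‖S.err x r - S.err x q‖ ≤ K * (‖S.err x t₀‖ + Real.exp (-b * t₀)) * (r - q) := by
  obtain ⟨K, hK, hgrow⟩ := exists_norm_err_growth (m := m) (a := a) hc hα hβ hG hf hs hb L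
  obtain ⟨C, hC, hlip⟩ := exists_err_lipschitz S (a := a) hc hs hb
  refine ⟨C * ((1 + Kf) * K + 1), by positivity, fun u x hx t₀ q r hq hqr hr => ?_⟩
  set D := ‖S.err x t₀‖ + Real.exp (-b * t₀) with hD
  have hD0 : 0 ≤ D := by positivity
  have h1 : (q : ℝ) ≤ r := by exact_mod_cast hqr
  refine (hlip u x hx t₀ (t₀ + L) ((1 + Kf) * K * D) (fun t ht ht' => ?_) q r hq hqr hr).trans ?_
  · have h2 : ‖S.err x t‖ ≤ K * D := hgrow u x hx t₀ t ht (by exact_mod_cast ht')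
    have hKf : 0 ≤ Kf * (K * D) := by positivity
    refine ⟨fun i => ?_, by nlinarith⟩
    have h3 : ‖S.f (x t i) - S.f (S.s t)‖ ≤ Kf * ‖x t i - S.s t‖ := hlf.norm_sub_le _ _
    have h4 : ‖x t i - S.s t‖ ≤ K * D := (norm_le_pi_norm (S.err x t) i).trans h2
    have h5 := mul_le_mul_of_nonneg_left h4 Kf.2
    have h6 : 0 ≤ K * D := by positivity
    have h7 : (Kf : ℝ) * (K * D) + K * D = (1 + Kf) * K * D := by ring
    exact h3.trans (h5.trans (by rw [← h7]; exact le_add_of_nonneg_right h6))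
  · refine mul_le_mul_of_nonneg_right ?_ (by linarith)
    have h8 : Real.exp (-b * t₀) ≤ D := le_add_of_nonneg_left (norm_nonneg _)
    rw [mul_assoc C]
    exact mul_le_mul_of_nonneg_left (by linarith) hC.le

/-- If the errors move slowly after an event, the next event is not too close. -/
theorem exists_event_separation (S : PinnedNetwork m n N) :
    ∃ C : ℝ, 0 < C ∧ ∀ {a b : ℝ} {u : ℝ≥0 → Fin N} {x : ℝ≥0 → Fin m → State n}
      {T : Fin m → ℕ → ℝ≥0∞}, S.IsRun (thrExp a b) u x T → 0 ≤ a → 0 ≤ b →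
      ∀ (i : Fin m) (k : ℕ) (p h : ℝ≥0) (M : ℝ), T i k = p → 0 ≤ M →
        (∀ q, p ≤ q → q ≤ p + h → ‖S.err x q - S.err x p‖ ≤ M * (q - p)) →
        C * (M * h) ≤ a * Real.exp (-b * (p + h)) → (h : ℝ≥0∞) ≤ T i (k + 1) - T i k := by
  obtain ⟨C, hC, hφ⟩ := S.exists_feedbackMap_bound
  refine ⟨C, hC, fun {a b u x T} hrun ha hb i k p h M hp hM hlip hh => ?_⟩
  refine ENNReal.le_sub_of_add_le_left (by simp [hp]) ?_
  rw [hp, ← ENNReal.coe_add]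
  refine hrun.le_next (by rw [hp]; exact_mod_cast le_self_add) fun q hq hq' => ?_
  rw [hp] at hq ⊢
  have hpq : p ≤ q := by exact_mod_cast hq
  rw [ENNReal.toNNReal_coe, meas_eq_feedbackMap]
  have h1 : (q : ℝ) - p ≤ h := by
    have : (q : ℝ) ≤ p + h := by exact_mod_cast hq'
    linarith
  calc _ ≤ C * (M * (q - p)) := (hφ _ _ _).trans (by gcongr; exact hlip q hpq hq')
    _ ≤ C * (M * h) := by gcongr
    _ ≤ _ := hh
    _ ≤ a * Real.exp (-b * q) := by
      gcongr _ * ?_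
      exact Real.exp_le_exp.2 (by nlinarith)

end PinnedNetwork

/-! ### Right derivatives and a comparison principle -/

theorem tendsto_const_add_nhdsGT_zero (t : ℝ≥0) :
    Tendsto (fun h : ℝ≥0 => t + h) (𝓝[>] 0) (𝓝[>] t) := by
  refine tendsto_nhdsWithin_of_tendsto_nhds_of_eventually_within _ ?_ ?_
  · have : Tendsto (fun h : ℝ≥0 => t + h) (𝓝 0) (𝓝 (t + 0)) :=
      (continuous_const.add continuous_id).tendsto 0
    rw [add_zero] at this
    exact this.mono_left nhdsWithin_le_nhds
  · filter_upwards [self_mem_nhdsWithin] with h hh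
    exact lt_add_of_pos_right t hh

/-- Right derivatives of functions of a nonnegative time. -/
theorem hasDerivWithinAt_toNNReal_iff {f : ℝ≥0 → ℝ} {c : ℝ} {t : ℝ≥0} :
    HasDerivWithinAt (fun r : ℝ => f r.toNNReal) c (Set.Ici (t : ℝ)) t ↔
      Tendsto (fun h : ℝ≥0 => (f (t + h) - f t) / h) (𝓝[>] 0) (𝓝 c) := by
  rw [← hasDerivWithinAt_Ioi_iff_Ici, hasDerivWithinAt_iff_tendsto_slope' (by simp)]
  constructor
  · intro H
    have h1 : Tendsto (fun h : ℝ≥0 => ((t + h : ℝ≥0) : ℝ)) (𝓝[>] 0) (𝓝[>] (t : ℝ)) := by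
      refine tendsto_nhdsWithin_of_tendsto_nhds_of_eventually_within _ ?_ ?_
      · exact (NNReal.continuous_coe.tendsto t).comp
          ((tendsto_const_add_nhdsGT_zero t).mono_right nhdsWithin_le_nhds)
      · filter_upwards [self_mem_nhdsWithin] with h hh
        exact NNReal.coe_lt_coe.2 (lt_add_of_pos_right t hh)
    refine (H.comp h1).congr fun h => ?_
    simp only [Function.comp, slope_def_field, Real.toNNReal_coe]
    simp
  · intro H
    have h1 : Tendsto (fun r : ℝ => (r - t).toNNReal) (𝓝[>] (t : ℝ)) (𝓝[>] 0) := by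
      refine tendsto_nhdsWithin_of_tendsto_nhds_of_eventually_within _ ?_ ?_
      · have : Tendsto (fun r : ℝ => (r - t).toNNReal) (𝓝 (t : ℝ)) (𝓝 ((t : ℝ) - t).toNNReal) :=
          (continuous_real_toNNReal.comp (continuous_id.sub continuous_const)).tendsto _
        simp only [sub_self, Real.toNNReal_zero] at this
        exact this.mono_left nhdsWithin_le_nhds
      · filter_upwards [self_mem_nhdsWithin] with r hr
        exact Real.toNNReal_pos.2 (sub_pos.2 hr)
    refine (H.comp h1).congr' ?_
    filter_upwards [self_mem_nhdsWithin] with r hr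
    have hr' : (t : ℝ) < r := hr
    have h2 : ((r - t).toNNReal : ℝ) = r - t := Real.coe_toNNReal _ (by linarith)
    have h3 : t + (r - t).toNNReal = r.toNNReal := by
      rw [← NNReal.coe_inj, NNReal.coe_add, h2, Real.coe_toNNReal _ (t.2.trans hr'.le)]
      ring
    simp only [Function.comp, slope_def_field, Real.toNNReal_coe, h2, h3]

/-- A function whose right derivative is at most `-2 β v + C exp(-2 b t)`, with `b < β`, decays
like `exp(-2 b t)`. -/
theorem exists_exp_decay {v v' : ℝ → ℝ} {β b C : ℝ} (hβ : b < β)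
    (hcont : ∀ R : ℝ, ContinuousOn v (Set.Icc 0 R))
    (hd : ∀ t, 0 ≤ t → HasDerivWithinAt v (v' t) (Set.Ici t) t)
    (hv : ∀ t, 0 ≤ t → v' t ≤ -(2 * β) * v t + C * Real.exp (-(2 * b) * t)) :
    ∃ D : ℝ, 0 < D ∧ ∀ t, 0 ≤ t → v t ≤ D * Real.exp (-(2 * b) * t) := by
  have hpos : 0 < 2 * (β - b) := by linarith
  have hne : β - b ≠ 0 := by linarith
  refine ⟨|v 0| + |C| / (2 * (β - b)) + 1, by positivity, fun t ht => ?_⟩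
  set D := |v 0| + |C| / (2 * (β - b)) + 1 with hD
  refine image_le_of_liminf_slope_right_lt_deriv_boundary (f' := v')
    (B := fun t => D * Real.exp (-(2 * b) * t))
    (B' := fun t => D * (Real.exp (-(2 * b) * t) * (-(2 * b)))) (hcont t)
    (fun x hx r hr => (hd x hx.1).liminf_right_slope_le hr) ?_ ?_ ?_ ⟨ht, le_rfl⟩
  · simp only [mul_zero, Real.exp_zero, mul_one]
    have := le_abs_self (v 0)
    have : 0 ≤ |C| / (2 * (β - b)) := by positivity
    linarith
  · intro x
    have h1 : HasDerivAt (fun x : ℝ => -(2 * b) * x) (-(2 * b)) x := by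
      simpa using (hasDerivAt_id x).const_mul (-(2 * b))
    exact h1.exp.const_mul D
  · intro x hx hxB
    refine (hv x hx.1).trans_lt ?_
    rw [hxB]
    -- The choice of `D` makes this strict: where `v` meets the barrier `D exp(-2 b t)`, it has the
    -- smaller slope and cannot cross.
    have h1 : C < 2 * (β - b) * D := by
      have h2 : 2 * (β - b) * D = 2 * (β - b) * (|v 0| + 1) + |C| := by
        rw [hD]
        field_simp
        ring
      have h3 := le_abs_self C
      have h4 : 0 < 2 * (β - b) * (|v 0| + 1) := by positivity
      linarith
    have := mul_lt_mul_of_pos_right h1 (Real.exp_pos (-(2 * b) * x))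
    linarith

theorem measurable_select {N : ℕ} {Ω : Type*} {m₀ : MeasurableSpace Ω} {s : Ω → Fin N} (hs : Measurable s)
    {F : Fin N → Ω → ℝ} (hF : ∀ v, Measurable (F v)) : Measurable fun ω => F (s ω) ω := by
  have : (fun ω => F (s ω) ω) = fun ω => ∑ u, {ω | s ω = u}.indicator (F u) ω := by
    ext ω
    rw [Finset.sum_eq_single (s ω)] <;> simp +contextual [Set.indicator, eq_comm]
  rw [this]
  exact Finset.measurable_sum _ fun u _ => (hF u).indicator (hs (measurableSet_singleton u))

/-! ### Dynkin's formula for the chain -/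

section Chain

variable {N : ℕ} {Ω : Type*} [mΩ : MeasurableSpace Ω] {μ : Measure Ω} [IsProbabilityMeasure μ]
  {ℱ : Filtration ℝ≥0 mΩ} {Q : Matrix (Fin N) (Fin N) ℝ} {σ : ℝ≥0 → Ω → Fin N}

/-- The Markov property for bounded functions. -/
theorem integral_indicator_of_markov {π : ℝ≥0 → Matrix (Fin N) (Fin N) ℝ}
    (hσ : ∀ t, Measurable[ℱ t] (σ t))
    (hm : ∀ (t h : ℝ≥0) (A : Set Ω), MeasurableSet[ℱ t] A → ∀ u v : Fin N,
      μ.real (A ∩ {ω | σ t ω = u} ∩ {ω | σ (t + h) ω = v}) =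
        μ.real (A ∩ {ω | σ t ω = u}) * π h u v)
    (t h : ℝ≥0) (u v : Fin N) {g : Ω → ℝ} (hg : Measurable[ℱ t] g) {M : ℝ}
    (hgM : ∀ ω, |g ω| ≤ M) :
    ∫ ω, ({ω | σ t ω = u} ∩ {ω | σ (t + h) ω = v}).indicator g ω ∂μ =
      π h u v * ∫ ω, {ω | σ t ω = u}.indicator g ω ∂μ := by
  have hU : MeasurableSet[ℱ t] {ω | σ t ω = u} := hσ t (measurableSet_singleton u)
  have hU' : MeasurableSet {ω | σ t ω = u} := ℱ.le t _ hU
  have hV : MeasurableSet {ω | σ (t + h) ω = v} := ℱ.le _ _ (hσ (t + h) (measurableSet_singleton v))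
  set A := {ω | σ t ω = u}
  set B := {ω | σ t ω = u} ∩ {ω | σ (t + h) ω = v} with hB
  have hBm : MeasurableSet B := hU'.inter hV
  have hBi : Integrable (B.indicator (1 : Ω → ℝ)) μ :=
    (integrable_const (1 : ℝ)).indicator hBm
  -- The Markov property, stated for sets, identifies a conditional expectation; the `ℱ
  -- t`-measurable factor `g` can then be pulled out.
  have hce : (fun ω => π h u v * A.indicator 1 ω) =ᵐ[μ] μ[B.indicator 1 | ℱ t] := by
    refine ae_eq_condExp_of_forall_setIntegral_eq (ℱ.le t) hBi ?_ ?_ ?_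
    · intro s _ _
      exact (((integrable_const (1 : ℝ)).indicator hU').const_mul _).integrableOn
    · intro s hs _
      have hs' := ℱ.le t _ hs
      rw [integral_const_mul, integral_indicator_one hU', integral_indicator_one hBm,
        measureReal_restrict_apply hU', measureReal_restrict_apply hBm, Set.inter_comm A s,
        Set.inter_comm B s, hB, ← Set.inter_assoc, hm t h s hs u v, mul_comm]
    · exact ((measurable_const.indicator hU).const_mul _).stronglyMeasurable.aestronglyMeasurable
  have hgi : Integrable g μ := Integrable.of_bound
    (hg.mono (ℱ.le t) le_rfl).aestronglyMeasurable M (ae_of_all _ hgM)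
  have h1 : ∀ s : Set Ω, s.indicator g = g * s.indicator 1 := fun s => by
    ext ω
    by_cases hω : ω ∈ s <;> simp [hω]
  have hgB : Integrable (g * B.indicator 1) μ := h1 B ▸ hgi.indicator hBm
  have hpull := condExp_mul_of_stronglyMeasurable_left hg.stronglyMeasurable hgB hBi
  calc ∫ ω, B.indicator g ω ∂μ = ∫ ω, μ[g * B.indicator 1 | ℱ t] ω ∂μ := by
        rw [integral_condExp, h1]
    _ = ∫ ω, π h u v * A.indicator g ω ∂μ := by
        refine integral_congr_ae ?_
        filter_upwards [hpull, hce] with ω h2 h3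
        rw [h2, Pi.mul_apply, ← h3, h1 A]
        simp only [Pi.mul_apply]
        ring
    _ = _ := integral_const_mul _ _

variable {F : Fin N → ℝ≥0 → Ω → ℝ} {M : ℝ} {R : ℝ≥0}

/-- Split according to the modes at times `t` and `t + h`. The terms `u = v` vanish, so only
transitions between distinct modes matter, and these have probability of order `h`. -/
theorem integral_jump {π : ℝ≥0 → Matrix (Fin N) (Fin N) ℝ}
    (hσ : ∀ t, Measurable[ℱ t] (σ t))
    (hm : ∀ (t h : ℝ≥0) (A : Set Ω), MeasurableSet[ℱ t] A → ∀ u v : Fin N,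
      μ.real (A ∩ {ω | σ t ω = u} ∩ {ω | σ (t + h) ω = v}) =
        μ.real (A ∩ {ω | σ t ω = u}) * π h u v)
    {g : Fin N → Ω → ℝ} (t h : ℝ≥0) (hg : ∀ v, Measurable[ℱ t] (g v))
    (hgM : ∀ v ω, |g v ω| ≤ M) :
    ∫ ω, (g (σ (t + h) ω) ω - g (σ t ω) ω) ∂μ =
      ∑ u, ∑ v, π h u v * ∫ ω, {ω | σ t ω = u}.indicator (g v - g u) ω ∂μ := by
  have h1 : ∀ ω, g (σ (t + h) ω) ω - g (σ t ω) ω =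
      ∑ u, ∑ v, ({ω | σ t ω = u} ∩ {ω | σ (t + h) ω = v}).indicator (g v - g u) ω := by
    intro ω
    rw [Finset.sum_eq_single (σ t ω), Finset.sum_eq_single (σ (t + h) ω)] <;>
      simp +contextual [Set.indicator, eq_comm]
  have hgM' : ∀ u v ω, |(g v - g u) ω| ≤ 2 * M := fun u v ω => by
    have := abs_sub (g v ω) (g u ω)
    have := hgM v ω
    have := hgM u ω
    simp only [Pi.sub_apply]
    linarith
  have hmeas : ∀ u v, Measurable[ℱ t] (g v - g u) := fun u v => (hg v).sub (hg u)
  have hset : ∀ r u, MeasurableSet {ω | σ r ω = u} := fun r u =>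
    ℱ.le r _ (hσ r (measurableSet_singleton u))
  have hint : ∀ u v, Integrable
      (({ω | σ t ω = u} ∩ {ω | σ (t + h) ω = v}).indicator (g v - g u)) μ := fun u v =>
    (Integrable.of_bound ((hmeas u v).mono (ℱ.le t) le_rfl).aestronglyMeasurable (2 * M)
      (ae_of_all _ (hgM' u v))).indicator ((hset _ _).inter (hset _ _))
  simp_rw [h1]
  rw [integral_finsetSum _ fun u _ => integrable_finsetSum _ fun v _ => hint u v]
  refine Finset.sum_congr rfl fun u _ => ?_
  rw [integral_finsetSum _ fun v _ => hint u v]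
  exact Finset.sum_congr rfl fun v _ =>
    integral_indicator_of_markov hσ hm t h u v (hmeas u v) (hgM' u v)

theorem tendsto_rate {π : ℝ≥0 → Matrix (Fin N) (Fin N) ℝ}
    (hπ : ∀ u v, (fun h : ℝ≥0 => π h u v - ((1 : Matrix (Fin N) (Fin N) ℝ) u v + Q u v * h))
      =o[𝓝[>] 0] (fun h : ℝ≥0 => (h : ℝ))) {u v : Fin N} (huv : u ≠ v) :
    Tendsto (fun h : ℝ≥0 => π h u v / h) (𝓝[>] 0) (𝓝 (Q u v)) := by
  have h1 := ((hπ u v).tendsto_div_nhds_zero).add_const (Q u v)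
  rw [zero_add] at h1
  refine h1.congr' ?_
  filter_upwards [self_mem_nhdsWithin] with h hh
  have : (h : ℝ) ≠ 0 := NNReal.coe_ne_zero.2 (ne_of_gt hh)
  rw [Matrix.one_apply_ne huv]
  field_simp
  ring

theorem tendsto_integral_jump (hσ : IsMarkovChain μ ℱ Q σ) {g : Fin N → Ω → ℝ} (t : ℝ≥0)
    (hg : ∀ v, Measurable[ℱ t] (g v)) (hgM : ∀ v ω, |g v ω| ≤ M) :
    Tendsto (fun h : ℝ≥0 => (∫ ω, (g (σ (t + h) ω) ω - g (σ t ω) ω) ∂μ) / h) (𝓝[>] 0)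
      (𝓝 (∫ ω, ∑ v, Q (σ t ω) v * g v ω ∂μ)) := by
  obtain ⟨π, hπ, hm⟩ := hσ.markov
  have hset : ∀ r u, MeasurableSet {ω | σ r ω = u} := fun r u =>
    ℱ.le r _ (hσ.adapted r (measurableSet_singleton u))
  have hgi : ∀ v, Integrable (g v) μ := fun v => Integrable.of_bound
    ((hg v).mono (ℱ.le t) le_rfl).aestronglyMeasurable M (ae_of_all _ (hgM v))
  -- Zero row sums of the generator allow `g v` to be replaced by `g v - g u`.
  have hlim : ∫ ω, ∑ v, Q (σ t ω) v * g v ω ∂μ =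
      ∑ u, ∑ v, Q u v * ∫ ω, {ω | σ t ω = u}.indicator (g v - g u) ω ∂μ := by
    have h1 : ∀ ω, ∑ v, Q (σ t ω) v * g v ω =
        ∑ u, ∑ v, Q u v * {ω | σ t ω = u}.indicator (g v - g u) ω := by
      intro ω
      symm
      rw [Finset.sum_eq_single (σ t ω)]
      · simp [mul_sub, Finset.sum_sub_distrib, ← Finset.sum_mul, hσ.row_sum]
      · simp +contextual [Set.indicator, eq_comm]
      · simp
    have hint : ∀ u v, Integrable
        (fun ω => Q u v * {ω | σ t ω = u}.indicator (g v - g u) ω) μ := fun u v =>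
      (((hgi v).sub (hgi u)).indicator (hset _ _)).const_mul _
    simp_rw [h1]
    rw [integral_finsetSum _ fun u _ => integrable_finsetSum _ fun v _ => hint u v]
    refine Finset.sum_congr rfl fun u _ => ?_
    rw [integral_finsetSum _ fun v _ => hint u v]
    exact Finset.sum_congr rfl fun v _ => integral_const_mul _ _
  rw [hlim]
  simp_rw [integral_jump hσ.adapted hm t _ hg hgM, Finset.sum_div, mul_div_right_comm]
  refine tendsto_finsetSum _ fun u _ => tendsto_finsetSum _ fun v _ => ?_
  by_cases huv : u = v
  · subst huv
    simp
  · exact (tendsto_rate hπ huv).mul_const _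

/-- Homogeneity of the chain makes the range of `h` and the constant independent of `t`. A
derivative from the right alone would not give continuity of the mean from the left. -/
theorem exists_integral_jump_bound (hσ : IsMarkovChain μ ℱ Q σ) (M : ℝ) :
    ∃ C : ℝ, 0 ≤ C ∧ ∀ᶠ h : ℝ≥0 in 𝓝[>] 0, ∀ (t : ℝ≥0) (g : Fin N → Ω → ℝ),
      (∀ v, Measurable[ℱ t] (g v)) → (∀ v ω, |g v ω| ≤ M) →
      |∫ ω, (g (σ (t + h) ω) ω - g (σ t ω) ω) ∂μ| ≤ C * h := by
  obtain ⟨π, hπ, hm⟩ := hσ.markov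
  have h1 : ∀ u v, u ≠ v → ∀ᶠ h : ℝ≥0 in 𝓝[>] 0, |π h u v| ≤ (|Q u v| + 1) * h := by
    intro u v huv
    have h2 := (tendsto_rate hπ huv).abs.eventually_lt_const (lt_add_one |Q u v|)
    filter_upwards [h2, self_mem_nhdsWithin] with h hh h0
    have h0' : (0 : ℝ) < h := by exact_mod_cast h0
    rw [abs_div, abs_of_pos h0', div_lt_iff₀ h0'] at hh
    exact hh.le
  have h3 : ∀ᶠ h : ℝ≥0 in 𝓝[>] 0, ∀ u v, u ≠ v → |π h u v| ≤ (|Q u v| + 1) * h := by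
    refine eventually_all.2 fun u => eventually_all.2 fun v => ?_
    by_cases huv : u = v
    · exact Eventually.of_forall fun _ h => absurd huv h
    · filter_upwards [h1 u v huv] with h hh _ using hh
  refine ⟨∑ u, ∑ v, (|Q u v| + 1) * (2 * |M|), by positivity, ?_⟩
  filter_upwards [h3] with h hh t g hg hgM
  rw [integral_jump hσ.adapted hm t h hg hgM, Finset.sum_mul]
  refine (Finset.abs_sum_le_sum_abs _ _).trans (Finset.sum_le_sum fun u _ => ?_)
  rw [Finset.sum_mul]
  refine (Finset.abs_sum_le_sum_abs _ _).trans (Finset.sum_le_sum fun v _ => ?_)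
  by_cases huv : u = v
  · subst huv
    simp
    positivity
  · have h4 : |∫ ω, {ω | σ t ω = u}.indicator (g v - g u) ω ∂μ| ≤ 2 * |M| := by
      rw [← Real.norm_eq_abs]
      refine (norm_integral_le_of_norm_le_const (C := 2 * |M|) (ae_of_all _ fun ω => ?_)).trans
        (by simp)
      refine (norm_indicator_le_norm_self _ _).trans ?_
      have := hgM v ω
      have := hgM u ω
      have := abs_sub (g v ω) (g u ω)
      have := le_abs_self M
      simp only [Pi.sub_apply, Real.norm_eq_abs]
      linarith
    rw [abs_mul]
    calc _ ≤ (|Q u v| + 1) * h * (2 * |M|) := by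
          gcongr
          exact hh u v huv
      _ = _ := by ring

theorem integrable_select (hσ : IsMarkovChain μ ℱ Q σ) (hFm : ∀ v t, Measurable[ℱ t] (F v t))
    (hFb : ∀ v ω, ∀ t ≤ R, |F v t ω| ≤ M) (r : ℝ≥0) {t : ℝ≥0} (ht : t ≤ R) :
    Integrable (fun ω => F (σ r ω) t ω) μ :=
  Integrable.of_bound (measurable_select ((hσ.adapted r).mono (ℱ.le r) le_rfl)
    fun v => (hFm v t).mono (ℱ.le t) le_rfl).aestronglyMeasurable M
    (ae_of_all _ fun ω => hFb _ ω t ht)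

/-- The evolution in time is taken in the new mode and the jump at the old time. The jump term then
involves only `ℱ t`-measurable fields, as the Markov property requires. -/
theorem integral_increment (hσ : IsMarkovChain μ ℱ Q σ) (hFm : ∀ v t, Measurable[ℱ t] (F v t))
    (hFb : ∀ v ω, ∀ t ≤ R, |F v t ω| ≤ M) {t h : ℝ≥0} (hth : t + h ≤ R) :
    (∫ ω, F (σ (t + h) ω) (t + h) ω ∂μ) - ∫ ω, F (σ t ω) t ω ∂μ =
      (∫ ω, (F (σ (t + h) ω) (t + h) ω - F (σ (t + h) ω) t ω) ∂μ) +
        ∫ ω, (F (σ (t + h) ω) t ω - F (σ t ω) t ω) ∂μ := by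
  have ht : t ≤ R := le_self_add.trans hth
  rw [integral_sub (integrable_select hσ hFm hFb _ hth) (integrable_select hσ hFm hFb _ ht),
    integral_sub (integrable_select hσ hFm hFb _ ht) (integrable_select hσ hFm hFb _ ht)]
  ring

/-- The mean of a Lipschitz random field along the chain is continuous. -/
theorem continuousOn_integral_select (hσ : IsMarkovChain μ ℱ Q σ)
    (hFm : ∀ v t, Measurable[ℱ t] (F v t))
    (hFb : ∀ v ω, ∀ t ≤ R, |F v t ω| ≤ M)
    (hFl : ∀ v ω (q r : ℝ≥0), q ≤ r → r ≤ R → |F v r ω - F v q ω| ≤ M * (r - q)) :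
    ContinuousOn (fun r : ℝ => ∫ ω, F (σ r.toNNReal ω) r.toNNReal ω ∂μ) (Set.Icc 0 (R : ℝ)) := by
  obtain ⟨C, hC, hev⟩ := exists_integral_jump_bound hσ M
  have hM : 0 ≤ M := by
    obtain ⟨ω⟩ := μ.nonempty_of_neZero
    exact (abs_nonneg _).trans (hFb (σ 0 ω) ω 0 zero_le)
  set V : ℝ≥0 → ℝ := fun t => ∫ ω, F (σ t ω) t ω ∂μ with hV
  obtain ⟨δ, hδ, hδ'⟩ := (mem_nhdsGT_iff_exists_Ioo_subset (a := (0 : ℝ≥0))).1 hev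
  have hδ0 : (0 : ℝ) < δ := by exact_mod_cast hδ
  have key : ∀ q r : ℝ≥0, q ≤ r → r ≤ R → (r : ℝ) - q < δ → |V r - V q| ≤ (M + C) * (r - q) := by
    intro q r hqr hr hd
    rcases hqr.eq_or_lt with rfl | hlt
    · simp
    obtain ⟨h, rfl⟩ := exists_add_of_le hqr
    have hh : (h : ℝ) < δ := by
      rw [NNReal.coe_add] at hd
      linarith
    have hhpos : 0 < h := by simpa using hlt
    have hq : q ≤ R := hqr.trans hr
    have hb := hδ' ⟨hhpos, NNReal.coe_lt_coe.1 hh⟩ q (fun v => F v q) (fun v => hFm v q)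
      (fun v ω => hFb v ω q hq)
    rw [hV]
    simp only
    rw [integral_increment hσ hFm hFb hr, NNReal.coe_add, add_sub_cancel_left, add_mul]
    refine (abs_add_le _ _).trans (add_le_add ?_ hb)
    rw [← Real.norm_eq_abs]
    refine (norm_integral_le_of_norm_le_const (C := M * h) (ae_of_all _ fun ω => ?_)).trans
      (by simp)
    have h1 := hFl (σ (q + h) ω) ω q (q + h) hqr hr
    rwa [NNReal.coe_add, add_sub_cancel_left] at h1
  have key' : ∀ q r : ℝ≥0, q ≤ R → r ≤ R → dist (r : ℝ) q < δ →
      dist (V r) (V q) ≤ (M + C) * dist (r : ℝ) q := by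
    intro q r hq hr hd
    rw [Real.dist_eq, Real.dist_eq] at *
    rcases le_total q r with hqr | hqr
    · have h1 : (0 : ℝ) ≤ r - q := sub_nonneg.2 (by exact_mod_cast hqr)
      rw [abs_of_nonneg h1] at hd ⊢
      exact key q r hqr hr hd
    · have h1 : (0 : ℝ) ≤ q - r := sub_nonneg.2 (by exact_mod_cast hqr)
      rw [abs_sub_comm, abs_of_nonneg h1] at hd
      rw [abs_sub_comm, abs_sub_comm (r : ℝ), abs_of_nonneg h1]
      exact key r q hqr hq hd
  refine Metric.continuousOn_iff.2 fun t ht ε hε => ?_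
  refine ⟨min δ (ε / (M + C + 1)), by positivity, fun r hr hrt => ?_⟩
  have h1 := key' t.toNNReal r.toNNReal (Real.toNNReal_le_iff_le_coe.2 ht.2)
    (Real.toNNReal_le_iff_le_coe.2 hr.2)
  rw [Real.coe_toNNReal _ ht.1, Real.coe_toNNReal _ hr.1] at h1
  refine (h1 (hrt.trans_le (min_le_left _ _))).trans_lt ?_
  have h2 := (lt_div_iff₀ (by positivity)).1 (hrt.trans_le (min_le_right _ _))
  nlinarith [dist_nonneg (x := r) (y := t)]

/-- Dynkin's formula in differential form, for a random field evaluated along the chain. -/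
theorem hasDerivWithinAt_integral_select (hσ : IsMarkovChain μ ℱ Q σ)
    (hFm : ∀ v t, Measurable[ℱ t] (F v t))
    (hFb : ∀ v ω, ∀ t ≤ R, |F v t ω| ≤ M)
    (hFl : ∀ v ω (q r : ℝ≥0), q ≤ r → r ≤ R → |F v r ω - F v q ω| ≤ M * (r - q))
    {t : ℝ≥0} (ht : t < R) {A : Ω → ℝ}
    (hA : ∀ ω, HasDerivWithinAt (fun r : ℝ => F (σ t ω) r.toNNReal ω) (A ω)
      (Set.Ici (t : ℝ)) t) :
    Integrable (fun ω => A ω + ∑ v, Q (σ t ω) v * F v t ω) μ ∧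
    HasDerivWithinAt (fun r : ℝ => ∫ ω, F (σ r.toNNReal ω) r.toNNReal ω ∂μ)
      (∫ ω, (A ω + ∑ v, Q (σ t ω) v * F v t ω) ∂μ) (Set.Ici (t : ℝ)) t := by
  have hR : ∀ᶠ h : ℝ≥0 in 𝓝[>] 0, t + h ≤ R := by
    filter_upwards [(tendsto_const_add_nhdsGT_zero t).eventually
      (mem_nhdsWithin_of_mem_nhds (Iic_mem_nhds ht))] with h hh using hh
  set D : ℝ≥0 → Ω → ℝ := fun h ω =>
    (F (σ (t + h) ω) (t + h) ω - F (σ (t + h) ω) t ω) / h with hD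
  have hDm : ∀ h, AEStronglyMeasurable (D h) μ := fun h => by
    have h1 : ∀ r, Measurable fun ω => F (σ (t + h) ω) r ω := fun r =>
      measurable_select ((hσ.adapted _).mono (ℱ.le _) le_rfl)
        fun v => (hFm v r).mono (ℱ.le r) le_rfl
    exact (((h1 (t + h)).sub (h1 t)).div_const _).aestronglyMeasurable
  have hDb : ∀ᶠ h : ℝ≥0 in 𝓝[>] 0, ∀ ω, ‖D h ω‖ ≤ M := by
    filter_upwards [hR, self_mem_nhdsWithin] with h hh h0 ω
    have h0' : (0 : ℝ) < h := by exact_mod_cast h0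
    have h1 := hFl (σ (t + h) ω) ω t (t + h) le_self_add hh
    rw [NNReal.coe_add, add_sub_cancel_left] at h1
    rwa [hD, Real.norm_eq_abs, abs_div, abs_of_pos h0', div_le_iff₀ h0']
  -- For each path the mode equals `σ t` on some interval to the right of `t`, so these quotients
  -- eventually are those of a fixed mode.
  have hDlim : ∀ ω, Tendsto (fun h => D h ω) (𝓝[>] 0) (𝓝 (A ω)) := fun ω => by
    have h1 := hasDerivWithinAt_toNNReal_iff (f := fun r => F (σ t ω) r ω).1 (hA ω)
    refine h1.congr' ?_
    filter_upwards [(tendsto_const_add_nhdsGT_zero t).eventually (hσ.right_continuous ω t)]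
      with h hh
    simp only [hD, hh]
  have hAm : AEStronglyMeasurable A μ :=
    aestronglyMeasurable_of_tendsto_ae (𝓝[>] (0 : ℝ≥0)) hDm (ae_of_all _ hDlim)
  have hAb : ∀ ω, ‖A ω‖ ≤ M := fun ω =>
    le_of_tendsto (hDlim ω).norm (hDb.mono fun h hh => hh ω)
  have hAi : Integrable A μ := Integrable.of_bound hAm M (ae_of_all _ hAb)
  have h1 := tendsto_integral_filter_of_dominated_convergence (μ := μ) (fun _ => M)
    (Eventually.of_forall hDm) (hDb.mono fun h hh => ae_of_all _ hh) (integrable_const M)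
    (ae_of_all _ hDlim)
  have h2 := tendsto_integral_jump (M := M) hσ (g := fun v => F v t) t (fun v => hFm v t)
    (fun v ω => hFb v ω t ht.le)
  have hQi : Integrable (fun ω => ∑ v, Q (σ t ω) v * F v t ω) μ := by
    refine integrable_finsetSum _ fun v _ => ?_
    refine Integrable.bdd_mul (c := ∑ u, |Q u v|) (Integrable.of_bound
      ((hFm v t).mono (ℱ.le t) le_rfl).aestronglyMeasurable M
      (ae_of_all _ fun ω => hFb v ω t ht.le)) ?_ (ae_of_all _ fun ω => ?_)
    · exact (measurable_select (F := fun u _ => Q u v) ((hσ.adapted t).mono (ℱ.le t) le_rfl)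
        fun _ => measurable_const).aestronglyMeasurable
    · exact Finset.single_le_sum (f := fun u => |Q u v|) (fun _ _ => abs_nonneg _)
        (Finset.mem_univ (σ t ω))
  refine ⟨hAi.add hQi, (hasDerivWithinAt_toNNReal_iff
    (f := fun r => ∫ ω, F (σ r ω) r ω ∂μ)).2 ?_⟩
  rw [integral_add hAi hQi]
  refine (h1.add h2).congr' ?_
  filter_upwards [hR] with h hh
  rw [integral_increment hσ hFm hFb hh, add_div]
  simp only [hD, integral_div]

end Chain

/-! ### The eigenvalue ratio -/

theorem lamMin_div_lamMax_le_one {m n N : ℕ} (p : Fin N → Fin m → ℝ)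
    (G : Matrix (Fin n) (Fin n) ℝ) : lamMin p G / lamMax p G ≤ 1 := by
  have hfin : ∀ u, ((fun μ : ℝ => |μ|) '' spectrum ℝ (lyap p G u)).Finite := fun u =>
    (Matrix.finite_real_spectrum).image _
  have h0 : ∀ u, 0 ≤ sInf ((fun μ : ℝ => |μ|) '' spectrum ℝ (lyap p G u)) := fun u =>
    Real.sInf_nonneg (by rintro _ ⟨x, -, rfl⟩; exact abs_nonneg x)
  have h1 : ∀ u, sInf ((fun μ : ℝ => |μ|) '' spectrum ℝ (lyap p G u)) ≤
      sSup ((fun μ : ℝ => |μ|) '' spectrum ℝ (lyap p G u)) := fun u =>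
    Real.sInf_le_sSup _ (hfin u).bddBelow (hfin u).bddAbove
  refine div_le_one_of_le₀ ?_ (Real.iSup_nonneg fun u => (h0 u).trans (h1 u))
  rcases isEmpty_or_nonempty (Fin N) with hN | ⟨⟨u⟩⟩
  · simp [lamMin, lamMax]
  · exact (ciInf_le (Set.finite_range _).bddBelow u).trans
      ((h1 u).trans (le_ciSup (f := fun u => sSup ((fun μ : ℝ => |μ|) '' spectrum ℝ (lyap p G u)))
        (Set.finite_range _).bddAbove u))

theorem lamMax_nonneg {m n N : ℕ} (p : Fin N → Fin m → ℝ)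
    (G : Matrix (Fin n) (Fin n) ℝ) : 0 ≤ lamMax p G :=
  Real.iSup_nonneg fun _ => Real.sSup_nonneg (by rintro _ ⟨x, -, rfl⟩; exact abs_nonneg x)

/-! ### Decay of the mean energy and concentration of the errors -/

namespace PinnedNetwork

theorem measurable_err {m n N : ℕ} {S : PinnedNetwork m n N} {Ω : Type*}
    {m₀ : MeasurableSpace Ω} {x : ℝ≥0 → Ω → Fin m → State n} {t : ℝ≥0} (hx : Measurable (x t)) :
    Measurable fun ω => S.err (fun t => x t ω) t :=
  measurable_pi_lambda _ fun i => ((measurable_pi_apply i).comp hx).sub_const _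

variable {m n N : ℕ} {S : PinnedNetwork m n N} {Q : Matrix (Fin N) (Fin N) ℝ}
  {G : Matrix (Fin n) (Fin n) ℝ} {p : Fin N → Fin m → ℝ} {α β a b : ℝ}
  {Ω : Type*} [mΩ : MeasurableSpace Ω] {μ : Measure Ω}
  {ℱ : Filtration ℝ≥0 mΩ} {σ : ℝ≥0 → Ω → Fin N}
  {x₀ : Fin m → State n} {x : ℝ≥0 → Ω → Fin m → State n} {T : Ω → Fin m → ℕ → ℝ≥0∞}

theorem continuous_energy (p : Fin N → Fin m → ℝ) (G : Matrix (Fin n) (Fin n) ℝ) (u : Fin N) :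
    Continuous (energy p G u) := by
  unfold energy weightedSq
  simp only [act_eq]
  fun_prop

/-- The mean energy along the chain decays like `exp(-2 b t)`. -/
theorem exists_integral_energy_decay [IsProbabilityMeasure μ] (hc : 0 < S.c) (hα : 0 < α)
    (hβ : 0 < β) (hG : G.PosDef) (hp : ∀ u i, 0 < p u i) (hf : IsQUAD S.f G S.Γ α β)
    (hs : S.IsTarget) (hLMI : StabilityLMI S Q p G α) (hσ : IsMarkovChain μ ℱ Q σ)
    (hb : 0 ≤ b) (hbβ : b < β) (hx : ∀ t, Measurable[ℱ t] (x t)) (hx0 : ∀ ω, x 0 ω = x₀)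
    (hpert : ∀ ω, S.IsPerturbed a b (fun t => σ t ω) (fun t => x t ω)) :
    ∃ D : ℝ, 0 < D ∧ ∀ t : ℝ≥0,
      Integrable (fun ω => energy p G (σ t ω) (S.err (fun t => x t ω) t)) μ ∧
      ∫ ω, energy p G (σ t ω) (S.err (fun t => x t ω) t) ∂μ ≤ D * Real.exp (-(2 * b) * t) := by
  set F : Fin N → ℝ≥0 → Ω → ℝ := fun v t ω => energy p G v (S.err (fun t => x t ω) t) with hF
  have hFm : ∀ v t, Measurable[ℱ t] (F v t) := fun v t =>
    (continuous_energy p G v).measurable.comp (measurable_err (hx t))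
  obtain ⟨C, hC, hlip⟩ := exists_weightedSq_lipschitz (m := m) hG.isHermitian p
  have hbounds : ∀ R : ℝ≥0, ∃ M : ℝ, (∀ v ω, ∀ t ≤ R, |F v t ω| ≤ M) ∧
      ∀ v ω (q r : ℝ≥0), q ≤ r → r ≤ R → |F v r ω - F v q ω| ≤ M * (r - q) := fun R => by
    obtain ⟨M, hM, hMb⟩ := exists_err_bounds (a := a) hc hα hβ hG hf hs hb x₀ R
    refine ⟨C * M * M, fun v ω t ht => ?_, fun v ω q r hqr hr => ?_⟩
    · have h1 := (hMb _ _ (hpert ω) (hx0 ω)).1 t ht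
      have h2 := hlip v (S.err (fun t => x t ω) t) 0
      have h3 : weightedSq G (p v) (0 : Fin m → State n) = 0 := by simp [weightedSq]
      rw [h3, norm_zero, add_zero, sub_zero, sub_zero] at h2
      have h4 : ‖S.err (fun t => x t ω) t‖ * ‖S.err (fun t => x t ω) t‖ ≤ M * M := by gcongr
      have h5 := mul_le_mul_of_nonneg_left h4 hC.le
      simp only [hF, energy, abs_mul]
      rw [abs_of_pos (by norm_num : (0 : ℝ) < 1 / 2)]
      nlinarith [mul_pos hC (mul_pos hM hM)]
    · obtain ⟨h1, h1'⟩ := hMb _ _ (hpert ω) (hx0 ω)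
      have h2 := hlip v (S.err (fun t => x t ω) r) (S.err (fun t => x t ω) q)
      have h3 := h1 r hr
      have h4 := h1 q (hqr.trans hr)
      have h5 := h1' q r hqr hr
      have h6 : (‖S.err (fun t => x t ω) r‖ + ‖S.err (fun t => x t ω) q‖) *
          ‖S.err (fun t => x t ω) r - S.err (fun t => x t ω) q‖ ≤ (M + M) * (M * (r - q)) := by
        gcongr
      have h7 := mul_le_mul_of_nonneg_left h6 hC.le
      simp only [hF, energy, ← mul_sub, abs_mul]
      rw [abs_of_pos (by norm_num : (0 : ℝ) < 1 / 2)]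
      linarith
  choose M hFb hFl using hbounds
  choose z hz hd using fun ω => (hpert ω).dynamics
  set A : ℝ≥0 → Ω → ℝ := fun t ω => ∑ i, p (σ t ω) i *
    inner ℝ (S.err (fun t => x t ω) t i) (act G (S.f (x t ω i) - S.f (S.s t) -
      S.c • S.feedbackMap (σ t ω) i (S.err (fun t => x t ω) t) + S.c • z ω t i)) with hA
  have hAd : ∀ t ω, HasDerivWithinAt (fun r : ℝ => F (σ t ω) r.toNNReal ω) (A t ω)
      (Set.Ici (t : ℝ)) t := fun t ω => by
    have h1 := (hasDerivWithinAt_weightedSq hG.isHermitian (p (σ t ω)) (hd ω t)).const_mul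
      (1 / 2 : ℝ)
    refine h1.congr_deriv ?_
    rw [Real.toNNReal_coe, ← mul_assoc]
    norm_num [hA]
  -- Bounds up to `t + 1` are used because the right derivative at `t` looks slightly beyond `t`.
  have hder := fun t : ℝ≥0 => hasDerivWithinAt_integral_select hσ hFm (hFb (t + 1)) (hFl (t + 1))
    (lt_add_one t) (hAd t)
  -- The midpoint of `b` and `β` leaves room on both sides: below `β` to absorb the disturbance,
  -- above `b` for the comparison.
  obtain ⟨C', hC', hdrift⟩ := energy_drift (S := S) (β' := (b + β) / 2) (by linarith)
    hG hp hf hLMI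
  have hFi : ∀ t, Integrable (fun ω => F (σ t ω) t ω) μ := fun t =>
    integrable_select hσ hFm (hFb t) t le_rfl
  obtain ⟨D, hD, hdecay⟩ := exists_exp_decay (b := b) (β := (b + β) / 2) (C := C' * a ^ 2)
    (v := fun r : ℝ => ∫ ω, F (σ r.toNNReal ω) r.toNNReal ω ∂μ)
    (v' := fun r : ℝ => ∫ ω, (A r.toNNReal ω + ∑ v, Q (σ r.toNNReal ω) v * F v r.toNNReal ω) ∂μ)
    (by linarith)
    (fun R => (continuousOn_integral_select hσ hFm (hFb R.toNNReal) (hFl R.toNNReal)).mono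
      (Set.Icc_subset_Icc_right (Real.le_coe_toNNReal R)))
    (fun t ht => by
      have h1 := (hder t.toNNReal).2
      rwa [Real.coe_toNNReal t ht] at h1)
    (fun t ht => by
      lift t to ℝ≥0 using ht
      simp only [Real.toNNReal_coe]
      rw [← integral_const_mul]
      have hpt : ∀ ω, A t ω + ∑ v, Q (σ t ω) v * F v t ω ≤
          -(2 * ((b + β) / 2)) * F (σ t ω) t ω + C' * a ^ 2 * Real.exp (-(2 * b) * t) :=
        fun ω => by
          refine (hdrift (σ t ω) (x t ω) (S.s t) (S.err (fun t => x t ω) t) (z ω t)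
            fun i => rfl).trans ?_
          have h1 := pow_le_pow_left₀ (norm_nonneg _) (hz ω t) 2
          have h2 : (a * Real.exp (-b * t)) ^ 2 = a ^ 2 * Real.exp (-(2 * b) * t) := by
            rw [mul_pow, ← Real.exp_nat_mul]
            congr 2
            push_cast
            ring
          rw [h2] at h1
          have h3 := mul_le_mul_of_nonneg_left h1 hC'.le
          rw [mul_assoc C']
          exact add_le_add le_rfl h3
      have hint : Integrable (fun ω => -(2 * ((b + β) / 2)) * F (σ t ω) t ω +
          C' * a ^ 2 * Real.exp (-(2 * b) * t)) μ :=
        ((hFi t).const_mul _).add (integrable_const _)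
      refine (integral_mono (hder t).1 hint hpt).trans ?_
      rw [integral_add ((hFi t).const_mul _) (integrable_const _)]
      simp)
  exact ⟨D, hD, fun t => ⟨hFi t, by simpa using hdecay t t.2⟩⟩

/-- With probability at least `1/2`, the errors at time `t` are of the size of `exp(-b t)`. -/
theorem exists_err_concentration [IsProbabilityMeasure μ] (hc : 0 < S.c) (hα : 0 < α)
    (hβ : 0 < β) (hG : G.PosDef) (hp : ∀ u i, 0 < p u i) (hf : IsQUAD S.f G S.Γ α β)
    (hs : S.IsTarget) (hLMI : StabilityLMI S Q p G α) (hσ : IsMarkovChain μ ℱ Q σ)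
    (hb : 0 ≤ b) (hbβ : b < β) (hx : ∀ t, Measurable[ℱ t] (x t)) (hx0 : ∀ ω, x 0 ω = x₀)
    (hpert : ∀ ω, S.IsPerturbed a b (fun t => σ t ω) (fun t => x t ω)) :
    ∃ K : ℝ, 0 < K ∧ ∀ t : ℝ≥0, ∃ E : Set Ω, MeasurableSet E ∧ 1 / 2 ≤ μ E ∧
      ∀ ω ∈ E, ‖S.err (fun t => x t ω) t‖ ≤ K * Real.exp (-b * t) := by
  obtain ⟨D, hD, hdecay⟩ := exists_integral_energy_decay hc hα hβ hG hp hf hs hLMI hσ hb hbβ hx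
    hx0 hpert
  obtain ⟨K, hK, hKe⟩ := exists_norm_sq_le_weightedSq (m := m) hG hp
  have hKe' : ∀ u (e : Fin m → State n), ‖e‖ ^ 2 ≤ K * (2 * energy p G u e) := fun u e => by
    refine (hKe u e).trans_eq ?_
    unfold energy
    ring
  refine ⟨Real.sqrt (4 * K * D), Real.sqrt_pos.2 (by positivity), fun t => ?_⟩
  obtain ⟨hint, hle⟩ := hdecay t
  set V : Ω → ℝ := fun ω => energy p G (σ t ω) (S.err (fun t => x t ω) t) with hV
  -- Twice the bound on the mean, so that Markov's inequality gives probability at most `1/2`.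
  set ε : ℝ := 2 * (D * Real.exp (-(2 * b) * t)) with hε
  have hεpos : 0 < ε := by positivity
  have hVm : Measurable V :=
    measurable_select (F := fun u ω => energy p G u (S.err (fun t => x t ω) t))
      ((hσ.adapted t).mono (ℱ.le t) le_rfl) fun u => (continuous_energy p G u).measurable.comp
        (measurable_err ((hx t).mono (ℱ.le t) le_rfl))
  have hV0 : ∀ ω, 0 ≤ V ω := fun ω => by
    have h1 := (sq_nonneg _).trans (hKe' (σ t ω) (S.err (fun t => x t ω) t))
    have h2 := nonneg_of_mul_nonneg_right h1 hK
    exact nonneg_of_mul_nonneg_right h2 two_pos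
  have hbad : MeasurableSet {ω | ε ≤ V ω} := measurableSet_le measurable_const hVm
  have hmarkov := mul_meas_ge_le_integral_of_nonneg (ae_of_all μ hV0) hint ε
  have hhalf : μ.real {ω | ε ≤ V ω} ≤ 1 / 2 := by
    have h1 : ε * μ.real {ω | ε ≤ V ω} ≤ ε * (1 / 2) := by
      refine hmarkov.trans (hle.trans_eq ?_)
      rw [hε]
      ring
    exact le_of_mul_le_mul_left h1 hεpos
  refine ⟨{ω | ε ≤ V ω}ᶜ, hbad.compl, ?_, fun ω hω => ?_⟩
  · have h1 := probReal_compl_eq_one_sub hbad (μ := μ)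
    have h2 : (1 / 2 : ℝ) ≤ μ.real {ω | ε ≤ V ω}ᶜ := by linarith
    have h3 := ENNReal.ofReal_le_ofReal h2
    rw [ofReal_measureReal] at h3
    refine le_trans (le_of_eq ?_) h3
    rw [ENNReal.ofReal_div_of_pos two_pos]
    simp
  · have h1 : V ω ≤ ε := (not_le.1 (show ¬ ε ≤ V ω from hω)).le
    have h2 : ‖S.err (fun t => x t ω) t‖ ^ 2 ≤ 4 * K * D * Real.exp (-b * t) ^ 2 := by
      refine (hKe' (σ t ω) _).trans ?_
      have h3 : Real.exp (-b * t) ^ 2 = Real.exp (-(2 * b) * t) := by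
        rw [← Real.exp_nat_mul]
        congr 1
        push_cast
        ring
      rw [h3]
      have h4 := mul_le_mul_of_nonneg_left h1 hK.le
      rw [hε] at h4
      linarith
    rw [← Real.sqrt_sq (norm_nonneg (S.err (fun t => x t ω) t))]
    refine (Real.sqrt_le_sqrt h2).trans_eq ?_
    rw [Real.sqrt_mul (by positivity), Real.sqrt_sq (Real.exp_pos _).le]

/-! ### Measurability of event times and lower bounds for intervals -/

/-- The event times of the exponential rule are random variables. -/
theorem measurable_event_time (hs : S.IsTarget) (hσ : IsMarkovChain μ ℱ Q σ) (ha : 0 < a)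
    (hx : ∀ t, Measurable[ℱ t] (x t))
    (hrun : ∀ ω, S.IsRun (thrExp a b) (fun t => σ t ω) (fun t => x t ω) (T ω)) (i : Fin m)
    (k : ℕ) : Measurable fun ω => T ω i k := by
  induction k with
  | zero =>
    have : (fun ω => T ω i 0) = fun _ => 0 := funext fun ω => (hrun ω).first_event i
    rw [this]
    exact measurable_const
  | succ k ih =>
    have hxm : Measurable fun ω => x (T ω i k).toNNReal ω :=
      (measurable_uncurry_of_continuous_of_measurable (u := x) (fun ω => (hrun ω).continuous)
        (fun t => (hx t).mono (ℱ.le t) le_rfl)).comp (ih.ennreal_toNNReal.prodMk measurable_id)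
    have hsm : Measurable fun ω => S.s (T ω i k).toNNReal :=
      hs.continuous.measurable.comp ih.ennreal_toNNReal
    have hem : Measurable fun ω => S.err (fun t => x t ω) (T ω i k).toNNReal :=
      measurable_pi_lambda _ fun j => ((measurable_pi_apply j).comp hxm).sub hsm
    have hzm : ∀ q : ℝ≥0, Measurable fun ω =>
        ‖S.meas (σ q ω) i (fun t => x t ω) (T ω i k).toNNReal q‖ := fun q => by
      simp only [meas_eq_feedbackMap]
      refine measurable_select (F := fun u ω => ‖S.feedbackMap u i
        (S.err (fun t => x t ω) q - S.err (fun t => x t ω) (T ω i k).toNNReal)‖)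
        ((hσ.adapted q).mono (ℱ.le q) le_rfl) fun u => ?_
      exact ((S.feedbackMap u i).continuous.measurable.comp
        ((measurable_err ((hx q).mono (ℱ.le q) le_rfl)).sub hem)).norm
    obtain ⟨d, hdc, hdd⟩ := TopologicalSpace.exists_countable_dense ℝ≥0
    refine measurable_of_Iio fun A => ?_
    -- The next event comes before `A` exactly if the threshold is exceeded at some earlier time
    -- after event `k`. Such a strict excess persists to the right, so a countable dense set of
    -- times detects it. Where `T ω i k = ⊤`, the first condition excludes the junk value of
    -- `toNNReal`.
    have hset : (fun ω => T ω i (k + 1)) ⁻¹' Set.Iio A =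
        ⋃ q ∈ {q ∈ d | (q : ℝ≥0∞) < A}, ({ω | T ω i k ≤ (q : ℝ≥0∞)} ∩
          {ω | a * Real.exp (-b * q) <
            ‖S.meas (σ q ω) i (fun t => x t ω) (T ω i k).toNNReal q‖}) := by
      ext ω
      simp only [Set.mem_preimage, Set.mem_Iio, Set.mem_iUnion, Set.mem_inter_iff,
        Set.mem_ofPred_eq, exists_prop]
      have hcont : Continuous fun q => thrExp a b q (x q ω i - S.s q) := continuous_thrExp a b _
      have hmono := (hrun ω).monotone hs i hcont (fun t => thrExp_pos ha b t _) (Nat.le_succ k)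
      constructor
      · intro hlt
        obtain ⟨r, hr, hrA⟩ := ENNReal.lt_iff_exists_nnreal_btwn.1 hlt
        have hle : ¬ ∀ q : ℝ≥0, T ω i k ≤ q → q ≤ r →
            ‖S.meas (σ q ω) i (fun t => x t ω) (T ω i k).toNNReal q‖ ≤
              thrExp a b q (x q ω i - S.s q) := fun h =>
          absurd hr (not_lt.2 ((hrun ω).le_next (hmono.trans hr.le) h))
        push Not at hle
        obtain ⟨q, hkq, hqr, hq⟩ := hle
        -- Freezing the mode at `q` makes the measurement error continuous; right-continuity of the
        -- chain restores the true mode just after `q`.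
        have hcz : Continuous fun t => ‖S.meas (σ q ω) i (fun t => x t ω) (T ω i k).toNNReal t‖ := by
          simp only [meas_eq_feedbackMap]
          exact ((S.feedbackMap _ i).continuous.comp
            ((PinnedNetwork.continuous_err hs (hrun ω).continuous).sub continuous_const)).norm
        have hev : ∀ᶠ t : ℝ≥0 in 𝓝[>] q, a * Real.exp (-b * t) <
            ‖S.meas (σ t ω) i (fun t => x t ω) (T ω i k).toNNReal t‖ ∧ (t : ℝ≥0∞) < A := by
          have h1 : ∀ᶠ t in 𝓝[>] q, thrExp a b t (x t ω i - S.s t) <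
              ‖S.meas (σ q ω) i (fun t => x t ω) (T ω i k).toNNReal t‖ :=
            nhdsWithin_le_nhds (hcont.continuousAt.eventually_lt hcz.continuousAt hq)
          have h2 : ∀ᶠ t : ℝ≥0 in 𝓝[>] q, (t : ℝ≥0∞) < A :=
            nhdsWithin_le_nhds (ENNReal.continuous_coe.continuousAt.eventually_lt_const
              (lt_of_le_of_lt (by exact_mod_cast hqr) hrA))
          filter_upwards [h1, h2, hσ.right_continuous ω q] with t ht1 ht2 ht3
          rw [ht3]
          exact ⟨ht1, ht2⟩
        obtain ⟨c, hqc, hcs⟩ := (mem_nhdsGT_iff_exists_Ioo_subset (a := q)).1 hev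
        obtain ⟨t, htd, ht⟩ := hdd.exists_between hqc
        obtain ⟨ht1, ht2⟩ := hcs ht
        exact ⟨t, ⟨htd, ht2⟩, hkq.trans (by exact_mod_cast ht.1.le), ht1⟩
      · rintro ⟨q, ⟨-, hqA⟩, hkq, hq⟩
        refine lt_of_le_of_lt (not_lt.1 fun hlt => ?_) hqA
        exact absurd ((hrun ω).meas_le hkq hlt) (not_le.2 hq)
    rw [hset]
    exact MeasurableSet.biUnion (hdc.mono fun q hq => hq.1) fun q _ =>
      (measurableSet_le ih measurable_const).inter (measurableSet_lt measurable_const (hzm q))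

/-- A lower bound for the inter-event intervals of all paths up to time `R`. -/
theorem exists_interval_bound (hc : 0 < S.c) (hα : 0 < α) (hβ : 0 < β) (hG : G.PosDef)
    (hf : IsQUAD S.f G S.Γ α β) (hs : S.IsTarget) (ha : 0 < a) (hb : 0 ≤ b)
    (x₀ : Fin m → State n) (R : ℝ≥0) :
    ∃ η : ℝ≥0, 0 < η ∧ ∀ (u : ℝ≥0 → Fin N) (y : ℝ≥0 → Fin m → State n) (τ : Fin m → ℕ → ℝ≥0∞),
      S.IsRun (thrExp a b) u y τ → y 0 = x₀ → ∀ i k, τ i k ≤ R →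
        (η : ℝ≥0∞) ≤ τ i (k + 1) - τ i k := by
  obtain ⟨M, hM, hMb⟩ := exists_err_bounds (a := a) hc hα hβ hG hf hs hb x₀ (R + 1)
  obtain ⟨C, hC, hsep⟩ := S.exists_event_separation
  -- Threshold at time `R + 1` divided by the largest growth rate of the measurement error. The cap
  -- `1` keeps an interval that starts by time `R` inside `[0, R + 1]`, where the bounds hold.
  set h : ℝ := min 1 (a * Real.exp (-b * (R + 1)) / (C * M)) with hh
  have hpos : 0 < h := by positivity
  refine ⟨h.toNNReal, Real.toNNReal_pos.2 hpos, fun u y τ hrun hy0 i k hk => ?_⟩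
  have htop : τ i k ≠ ⊤ := ne_top_of_le_ne_top ENNReal.coe_ne_top hk
  lift τ i k to ℝ≥0 using htop with q hq
  have hqR : q ≤ R := by exact_mod_cast hk
  have hh1 : h.toNNReal ≤ 1 := Real.toNNReal_le_one.2 (min_le_left _ _)
  rw [hq]
  refine hsep hrun ha.le hb i k q h.toNNReal M hq.symm hM.le
    (fun r hqr hr => (hMb u y (hrun.isPerturbed ha hs) hy0).2 q r hqr
      (hr.trans (add_le_add hqR hh1))) ?_
  rw [Real.coe_toNNReal _ hpos.le]
  have h1 : C * (M * h) ≤ a * Real.exp (-b * (R + 1)) := by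
    rw [← mul_assoc, mul_comm, ← le_div_iff₀ (by positivity)]
    exact min_le_right _ _
  refine h1.trans (mul_le_mul_of_nonneg_left (Real.exp_le_exp.2 ?_) ha.le)
  have h2 : (q : ℝ) ≤ R := by exact_mod_cast hqR
  have h3 : h ≤ 1 := min_le_left _ _
  nlinarith

/-- A lower bound for the inter-event intervals that meet `[t, t + l]`, uniform in `t`, for the
paths whose errors are of the size of the threshold one time unit before `t`. -/
theorem exists_interval_bound_of_lipschitz (hc : 0 < S.c) (hα : 0 < α) (hβ : 0 < β)
    (hG : G.PosDef) (hf : IsQUAD S.f G S.Γ α β) (hs : S.IsTarget) (ha : 0 < a) (hb : 0 ≤ b)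
    {Kf : ℝ≥0} (hlf : LipschitzWith Kf S.f) {K : ℝ} (hK : 0 < K) (l : ℝ≥0) :
    ∃ η : ℝ≥0, 0 < η ∧ ∀ (u : ℝ≥0 → Fin N) (y : ℝ≥0 → Fin m → State n) (τ : Fin m → ℕ → ℝ≥0∞),
      S.IsRun (thrExp a b) u y τ → ∀ t : ℝ≥0,
        ‖S.err y (t - 1)‖ ≤ K * Real.exp (-b * (t - 1 : ℝ≥0)) → ∀ i k,
          τ i k ≤ ((t + l : ℝ≥0) : ℝ≥0∞) → (t : ℝ≥0∞) < τ i (k + 1) →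
            (η : ℝ≥0∞) ≤ τ i (k + 1) - τ i k := by
  obtain ⟨K', hK', hlip⟩ := exists_err_lipschitz_of_lipschitz (m := m) (a := a) hc hα hβ hG hf hs
    hb hlf (l + 2)
  obtain ⟨C, hC, hsep⟩ := S.exists_event_separation
  -- The factor `exp(-b (t - 1))` common to threshold and speed has cancelled, so `h` does not
  -- depend on `t`. The window has length `l + 2`: one unit before `t`, then `l`, then at most one
  -- for the interval itself.
  set h : ℝ := min 1 (a * Real.exp (-b * (l + 2)) / (C * (K' * (K + 1)))) with hh
  have hpos : 0 < h := by positivity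
  refine ⟨h.toNNReal, Real.toNNReal_pos.2 hpos, fun u y τ hrun t hy i k hk hk' => ?_⟩
  have htop : τ i k ≠ ⊤ := ne_top_of_le_ne_top ENNReal.coe_ne_top hk
  obtain ⟨q, hq⟩ : ∃ q : ℝ≥0, (q : ℝ≥0∞) = τ i k := ⟨_, ENNReal.coe_toNNReal htop⟩
  have hh1 : h.toNNReal ≤ 1 := Real.toNNReal_le_one.2 (min_le_left _ _)
  have htt : t ≤ t - 1 + 1 := le_tsub_add
  rw [← hq] at hk
  have hqt : q ≤ t + l := by exact_mod_cast hk
  -- An interval that starts before `t - 1` and ends after `t` is longer than `1`. Otherwise it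
  -- starts inside the window. The subtraction is truncated, so for `t < 1` the window starts at
  -- `0`.
  rcases lt_or_ge q (t - 1) with hlt | hge
  · rw [← hq]
    refine ENNReal.le_sub_of_add_le_left (by simp) (le_trans ?_ hk'.le)
    rw [← ENNReal.coe_add, ENNReal.coe_le_coe]
    exact (add_le_add hlt.le hh1).trans
      (tsub_add_cancel_of_le (le_of_lt (tsub_pos_iff_lt.1 (lt_of_le_of_lt zero_le hlt)))).le
  · set t₀ := t - 1 with ht₀
    set E := Real.exp (-b * t₀) with hE
    have hEpos : 0 < E := Real.exp_pos _
    have hqh : q + h.toNNReal ≤ t₀ + (l + 2) := by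
      calc q + h.toNNReal ≤ (t₀ + 1 + l) + 1 := add_le_add (hqt.trans (by gcongr)) hh1
        _ = t₀ + (l + 2) := by ring
    refine hsep hrun ha.le hb i k q h.toNNReal (K' * ((K + 1) * E)) hq.symm (by positivity)
      (fun r hqr hr => ?_) ?_
    · refine (hlip u y (hrun.isPerturbed ha hs) t₀ q r hge hqr (hr.trans hqh)).trans ?_
      have h1 : (q : ℝ) ≤ r := by exact_mod_cast hqr
      refine mul_le_mul_of_nonneg_right (mul_le_mul_of_nonneg_left ?_ hK'.le) (by linarith)
      rw [add_mul, one_mul]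
      exact add_le_add hy le_rfl
    · have hqh' : (q : ℝ) + h.toNNReal ≤ t₀ + (l + 2) := by exact_mod_cast hqh
      rw [Real.coe_toNNReal _ hpos.le] at hqh' ⊢
      have h1 : C * (K' * (K + 1)) * h ≤ a * Real.exp (-b * (l + 2)) := by
        rw [mul_comm, ← le_div_iff₀ (by positivity)]
        exact min_le_right _ _
      have h2 := mul_le_mul_of_nonneg_right h1 hEpos.le
      calc C * (K' * ((K + 1) * E) * h) = C * (K' * (K + 1)) * h * E := by ring
        _ ≤ a * Real.exp (-b * (l + 2)) * E := h2
        _ = a * Real.exp (-b * (l + 2) + -b * t₀) := by rw [hE, Real.exp_add, mul_assoc]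
        _ ≤ _ := mul_le_mul_of_nonneg_left (Real.exp_le_exp.2 (by nlinarith)) ha.le

end PinnedNetwork

/-! ### The proposition -/

theorem proposition1 {m n N : ℕ} (S : PinnedNetwork m n N)
    (Q : Matrix (Fin N) (Fin N) ℝ) (G : Matrix (Fin n) (Fin n) ℝ) (p : Fin N → Fin m → ℝ)
    (α β : ℝ) (hc : 0 < S.c) (hε : 0 < S.ε) (hα : 0 < α) (hβ : 0 < β)
    (hG : G.PosDef) (hp : ∀ u i, 0 < p u i)
    (hf : IsQUAD S.f G S.Γ α β) (hs : S.IsTarget) (hLMI : StabilityLMI S Q p G α)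
    {Ω : Type*} [mΩ : MeasurableSpace Ω] (μ : Measure Ω) [IsProbabilityMeasure μ]
    (ℱ : Filtration ℝ≥0 mΩ) (σ : ℝ≥0 → Ω → Fin N) (hσ : IsMarkovChain μ ℱ Q σ)
    (x₀ : Fin m → State n) (x : ℝ≥0 → Ω → Fin m → State n) (T : Ω → Fin m → ℕ → ℝ≥0∞) :
    -- the state-dependent rule
    (∀ δ : ℝ, 0 < δ → δ < 2 * β * lamMin p G / lamMax p G →
      IsSolution ℱ S (thrState S.c β δ (lamMin p G) (lamMax p G)) σ x₀ x T →
      ∀ (ω : Ω) (t : ℝ≥0), (∀ r < t, PinnedNetwork.Alive (T ω) r) →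
        (∃ j, x t ω j ≠ S.s t) →
        ∃ i k, T ω i k ≤ t ∧ (t : ℝ≥0∞) < T ω i (k + 1)) ∧
    -- the exponential rule
    (∀ a b : ℝ, 0 < a → 0 < b → IsSolution ℱ S (thrExp a b) σ x₀ x T →
      -- inter-event intervals are positive, and events do not accumulate
      (∀ ω i k, T ω i k ≠ ⊤ → T ω i k < T ω i (k + 1)) ∧
      (∀ ω i, Tendsto (T ω i) atTop (𝓝 ⊤)) ∧
      -- the mean next interval after an event up to time `R`
      (∀ R : ℝ≥0, ∃ η : ℝ≥0, 0 < η ∧ ∀ i k,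
        η * μ {ω | T ω i k ≤ R} ≤
          ∫⁻ ω in {ω | T ω i k ≤ R}, (T ω i (k + 1) - T ω i k) ∂μ) ∧
      -- a bound uniform in time, for the shortest interval that meets `[t, t + l]`
      (b < β * lamMin p G / lamMax p G → (∃ K : ℝ≥0, LipschitzWith K S.f) →
        ∀ l : ℝ≥0, ∃ η : ℝ≥0, 0 < η ∧ ∀ (i : Fin m) (t : ℝ≥0),
          (η : ℝ≥0∞) ≤ ∫⁻ ω, (⨅ (k : ℕ) (_ : T ω i k ≤ ((t + l : ℝ≥0) : ℝ≥0∞) ∧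
            (t : ℝ≥0∞) < T ω i (k + 1)), (T ω i (k + 1) - T ω i k)) ∂μ)) := by
  refine ⟨fun δ hδ hδ' hsol ω t hA hne => ?_, fun a b ha hb hsol => ?_⟩
  · obtain ⟨j, hj⟩ := hne
    have hrun := hsol.run ω
    -- If `lamMax p G` were `0`, the upper bound for `δ` would be a division by zero, hence `0`,
    -- against `0 < δ`.
    have hmax : 0 < lamMax p G := by
      refine (lamMax_nonneg p G).lt_of_ne fun h => ?_
      rw [← h, div_zero] at hδ'
      linarith
    rw [lt_div_iff₀ hmax] at hδ'
    have hcoef : 0 < (β * lamMin p G - 1 / 2 * δ * lamMax p G) / (Real.sqrt S.c * lamMax p G) :=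
      div_pos (by linarith) (mul_pos (Real.sqrt_pos.2 hc) hmax)
    have hcont : Continuous fun q => thrState S.c β δ (lamMin p G) (lamMax p G) q
        (x q ω j - S.s q) := by
      have h1 : Continuous fun q => x q ω j := (continuous_apply j).comp hrun.continuous
      exact continuous_const.mul (h1.sub hs.continuous).norm
    exact ⟨j, hrun.exists_between_of_pos hs j hA hcont.continuousAt
      (mul_pos hcoef (norm_pos_iff.2 (sub_ne_zero.2 hj)))⟩
  · have hpert := fun ω => (hsol.run ω).isPerturbed ha hs
    refine ⟨fun ω i k hk => ?_, fun ω i => ?_, fun R => ?_, fun hbβ hlip l => ?_⟩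
    · exact (hsol.run ω).lt_next hs i (PinnedNetwork.continuous_thrExp a b _)
        (fun t => PinnedNetwork.thrExp_pos ha b t _) hk
    · exact (hsol.run ω).tendsto_top hs i (PinnedNetwork.continuous_thrExp a b _)
        (fun t => PinnedNetwork.thrExp_pos ha b t _)
    · obtain ⟨η, hη, hle⟩ := PinnedNetwork.exists_interval_bound hc hα hβ hG hf hs ha hb.le x₀ R
      refine ⟨η, hη, fun i k => ?_⟩
      have hm := PinnedNetwork.measurable_event_time hs hσ ha hsol.adapted hsol.run i k
      rw [← setLIntegral_const]
      exact setLIntegral_mono' (measurableSet_le hm measurable_const) fun ω hω =>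
        hle _ _ _ (hsol.run ω) (hsol.initial ω) i k hω
    · obtain ⟨Kf, hKf⟩ := hlip
      -- The ratio of the extreme eigenvalues is at most `1`. The energy argument works with `P(u) ⊗
      -- G` itself and needs no more than `b < β`.
      have hbβ' : b < β := by
        refine hbβ.trans_le ?_
        rw [mul_div_assoc]
        exact mul_le_of_le_one_right hβ.le (lamMin_div_lamMax_le_one p G)
      obtain ⟨K, hK, hconc⟩ := PinnedNetwork.exists_err_concentration hc hα hβ hG hp hf hs hLMI hσ
        hb.le hbβ' hsol.adapted hsol.initial hpert
      obtain ⟨η, hη, hle⟩ := PinnedNetwork.exists_interval_bound_of_lipschitz hc hα hβ hG hf hs ha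
        hb.le hKf hK l
      -- On an event of probability at least `1/2` every interval meeting the window is at least
      -- `η`; elsewhere the integrand is only known to be nonnegative.
      refine ⟨η / 2, by positivity, fun i t => ?_⟩
      obtain ⟨E, hEm, hE, herr⟩ := hconc (t - 1)
      calc ((η / 2 : ℝ≥0) : ℝ≥0∞) = η * (1 / 2) := by
            rw [ENNReal.coe_div two_ne_zero, ENNReal.div_eq_inv_mul, one_div, mul_comm]
            rfl
        _ ≤ η * μ E := by gcongr
        _ = ∫⁻ ω in E, η ∂μ := (setLIntegral_const _ _).symm
        _ ≤ ∫⁻ ω in E, _ ∂μ := setLIntegral_mono' hEm fun ω hω => le_iInf₂ fun k hk =>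
            hle _ _ _ (hsol.run ω) t (herr ω hω) i k hk.1 hk.2
        _ ≤ _ := setLIntegral_le_lintegral _ _
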